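/- **Conventions.** Write $C^\infty(U)$ for the $\mathbb R$-algebra of smooth real functions on an open $U\subseteq\mathbb R^k$. A *$C^\infty$-algebra* is a commutative $\mathbb R$-algebra $A$ together with operations $\hat f:A^n\to A$ for all $n$ and all smooth $f:\mathbb R^n\to\mathbb R$, compatible with projections and composition, such that the operations of $x_0+x_1$, $x_0x_1$ and of constants are those of the $\mathbb R$-algebra $A$; a *$C^\infty$-map* is an $\mathbb R$-algebra map commuting with all $\hat f$. $C^\infty(U)$ and its quotients by ideals are $C^\infty$-algebras in the evident way. The coproduct of $C^\infty$-algebras is denoted $\otimes_\infty$. A *Weil algebra* is a nonzero commutative $\mathbb R$-algebra $W=\mathbb R\cdot 1\oplus V$ with $V$ a finite-dimensional subspace consisting of nilpotent elements. $\mathrm{ThCartSp}$ is the opposite of the full subcategory of commutative $\mathbb R$-algebras on the algebras isomorphic to $C^\infty(\mathbb R^k)\otimes_{\mathbb R}W$, $W$ a Weil algebra, $k\ge 0$. $C^\infty\text{-}\mathrm{ThCartSp}$ is the opposite of the full subcategory of $C^\infty$-algebras on those isomorphic to $C^\infty(\mathbb R^k)\otimes_\infty W$, where $W$ is a $C^\infty$-algebra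 whose underlying $\mathbb R$-algebra is a Weil algebra. A *good open cover* of $\mathbb R^k$ is an open cover $(U_i)_{i\in I}$ all of whose nonempty finite intersections are diffeomorphic to $\mathbb R^k$. The *good open coverage* on either category consists of the families that are, up to isomorphism, dual to the families $C^\infty(\mathbb R^k)\otimes W\to C^\infty(U_i)\otimes W$ given by restriction $\otimes\ \mathrm{id}_W$, for a good open cover $(U_i)$ of $\mathbb R^k$ (with $\otimes=\otimes_{\mathbb R}$, resp. $\otimes=\otimes_\infty$). **Theorem.** 1. Let $k\ge0$ and let $W$ be a Weil algebra. There are $m$ and a surjective $\mathbb R$-algebra map $q:\mathbb R[y_1,\dots,y_m]\to W$ whose kernel contains a power $(y_1,\dots,y_m)^{l+1}$, $l\ge 0$. There is a $C^\infty$-algebra structure on $C^\infty(\mathbb R^k)\otimes_{\mathbb R}W$ such that: - for every such $m$ and $q$ there is an isomorphism of $\mathbb R$-algebras which is a $C^\infty$-map $$C^\infty(\mathbb R^k)\otimes_{\mathbb R}W\ \cong\ C^\infty(\mathbb R^{k+m})/\tilde I,\qquad g\otimes q(p)\mapsto [g(x)\,p(y)],$$ where $\tilde I$ is the ideal generated by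 the functions $p(y)$ with $p\in\ker q$; - every $\mathbb R$-algebra map $C^\infty(\mathbb R^{k'})\to C^\infty(\mathbb R^k)\otimes_{\mathbb R}W$ is a $C^\infty$-map; - more generally, if $I'\subseteq C^\infty(\mathbb R^{k'})$ is an ideal generated by finitely many polynomials, every $\mathbb R$-algebra map $\varphi:C^\infty(\mathbb R^{k'})/I'\to C^\infty(\mathbb R^k)\otimes_{\mathbb R}W$ is a $C^\infty$-map; and, under each of the above isomorphisms, it is induced by a smooth map $\psi:\mathbb R^{k+m}\to\mathbb R^{k'}$, that is, $\varphi([f])=[f\circ\psi]$ for all $f$. 2. Sending a $C^\infty$-algebra to its underlying $\mathbb R$-algebra restricts to a functor $F: C^\infty\text{-}\mathrm{ThCartSp}\to\mathrm{ThCartSp}$, and this functor is a strict isomorphism of categories. 3. $F$ is an isomorphism of sites: a family of morphisms with common target belongs to the good open coverage of $C^\infty\text{-}\mathrm{ThCartSp}$ if and only if its image under $F$ belongs to the good open coverage of $\mathrm{ThCartSp}$. 4. Consequently the Cahiers topos $\mathrm{Sh}(C^\infty\text{-}\mathrm{ThCartSp})$ (sheaves of sets for the good open coverage) is equivalent to $\mathrm{Sh}(\mathrm{ThCartSp})$,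 via precomposition with $F$. -/

import Mathlib

open CategoryTheory CategoryTheory.Limits TopologicalSpace Manifold
open scoped ContDiff TensorProduct

noncomputable section

namespace Cahiers

/-! ### Smooth functions -/

/-- The Cartesian space `ℝⁿ` (as a manifold; its norm plays no role). -/
abbrev Cart (n : ℕ) : Type := Fin n → ℝ

/-- `C^∞(ℝⁿ)`. -/
abbrev SmoothFn (n : ℕ) : Type := C^∞⟮𝓘(ℝ, Cart n), Cart n; 𝓘(ℝ, ℝ), ℝ⟯

/-- `C^∞(U)` for an open subset `U ⊆ ℝⁿ`. -/
abbrev SmoothFnOn {n : ℕ} (U : Opens (Cart n)) : Type := C^∞⟮𝓘(ℝ, Cart n), U; 𝓘(ℝ, ℝ), ℝ⟯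

/-- The `i`-th linear coordinate function on `ℝⁿ`. -/
def coord {n : ℕ} (i : Fin n) : SmoothFn n :=
  ⟨fun x => x i, (contDiff_apply ℝ ℝ i).contMDiff⟩

section Manifold

variable {E : Type*} [NormedAddCommGroup E] [NormedSpace ℝ E] {H : Type*} [TopologicalSpace H]
  {I : ModelWithCorners ℝ E H} {M : Type*} [TopologicalSpace M] [ChartedSpace H M]

/-- The smooth map `M → ℝⁿ` with components `g i`. -/
def tuple {n : ℕ} (g : Fin n → C^∞⟮I, M; 𝓘(ℝ, ℝ), ℝ⟯) : C^∞⟮I, M; 𝓘(ℝ, Cart n), Cart n⟯ :=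
  ⟨fun x i => g i x, contMDiff_pi_space.2 fun i => (g i).contMDiff⟩

end Manifold

/-- Pullback of smooth functions along a smooth map `ψ : ℝⁿ' → ℝⁿ`. -/
def pullback {n n' : ℕ} (ψ : C^∞⟮𝓘(ℝ, Cart n'), Cart n'; 𝓘(ℝ, Cart n), Cart n⟯) :
    SmoothFn n →ₐ[ℝ] SmoothFn n' where
  toFun f := f.comp ψ
  map_one' := rfl
  map_mul' _ _ := rfl
  map_zero' := rfl
  map_add' _ _ := rfl
  commutes' _ := rfl

/-- Restriction of smooth functions from `ℝⁿ` to an open subset. -/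
def restrict {n : ℕ} (U : Opens (Cart n)) : SmoothFn n →ₐ[ℝ] SmoothFnOn U where
  toFun f := ⟨fun x => f x, f.contMDiff.comp contMDiff_subtype_val⟩
  map_one' := rfl
  map_mul' _ _ := rfl
  map_zero' := rfl
  map_add' _ _ := rfl
  commutes' _ := rfl

/-- A polynomial in `n` variables, as a smooth function on `ℝⁿ`. -/
def polyFn (n : ℕ) : MvPolynomial (Fin n) ℝ →ₐ[ℝ] SmoothFn n := MvPolynomial.aeval coord

/-! ### `C^∞`-algebras -/

/-- A `C^∞`-algebra structure on a set `A`, organised over the underlying commutative `ℝ`-algebra: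
every smooth `f : ℝⁿ → ℝ` acts as an `n`-ary operation on `A`, compatibly with
projections and composition, and the operations of the smooth functions `x₀ + x₁`, `x₀ x₁` and of
the constants are those of the given `ℝ`-algebra. (Equivalently: a product-preserving functor from
Cartesian spaces to sets, whose induced `ℝ`-algebra is the given one.) -/
class CInftyAlgebra (A : Type*) [CommRing A] [Algebra ℝ A] where
  op : ∀ {n : ℕ}, SmoothFn n → (Fin n → A) → A
  op_coord : ∀ {n : ℕ} (i : Fin n) (a : Fin n → A), op (coord i) a = a i
  op_comp : ∀ {m n : ℕ} (f : SmoothFn m) (g : Fin m → SmoothFn n) (a : Fin n → A),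
    op (f.comp (tuple g)) a = op f (fun j => op (g j) a)
  op_add : ∀ a b : A, op (coord (0 : Fin 2) + coord 1) ![a, b] = a + b
  op_mul : ∀ a b : A, op (coord (0 : Fin 2) * coord 1) ![a, b] = a * b
  op_const : ∀ r : ℝ, op (n := 0) (ContMDiffMap.const r) ![] = algebraMap ℝ A r

/-- An `ℝ`-algebra map between `C^∞`-algebras is a `C^∞`-algebra map if it commutes with all
smooth operations. -/
def IsCInftyHom {A B : Type*} [CommRing A] [Algebra ℝ A] [CInftyAlgebra A] [CommRing B]
    [Algebra ℝ B] [CInftyAlgebra B] (φ : A →ₐ[ℝ] B) : Prop :=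
  ∀ {n : ℕ} (f : SmoothFn n) (a : Fin n → A),
    φ (CInftyAlgebra.op f a) = CInftyAlgebra.op f (fun i => φ (a i))

section Manifold

variable {E : Type*} [NormedAddCommGroup E] [NormedSpace ℝ E] {H : Type*} [TopologicalSpace H]
  {I : ModelWithCorners ℝ E H} {M : Type*} [TopologicalSpace M] [ChartedSpace H M]

/-- `C^∞(M)` is a `C^∞`-algebra by composition. -/
instance : CInftyAlgebra C^∞⟮I, M; 𝓘(ℝ, ℝ), ℝ⟯ where
  op f a := f.comp (tuple a)
  op_coord _ _ := rfl
  op_comp _ _ _ := rfl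
  op_add _ _ := rfl
  op_mul _ _ := rfl
  op_const _ := rfl

end Manifold

/-! ### Hadamard's lemma and quotients of `C^∞(M)` -/

theorem contDiff_integral_nat (n : ℕ) : ∀ {V W : Type} [NormedAddCommGroup V] [NormedSpace ℝ V]
    [FiniteDimensional ℝ V] [NormedAddCommGroup W] [NormedSpace ℝ W] (F : V → ℝ → W),
    ContDiff ℝ ∞ (fun p : V × ℝ => F p.1 p.2) →
    ContDiff ℝ n (fun x => ∫ t in (0 : ℝ)..1, F x t) := by
  induction n with
  | zero =>
    intro V W _ _ _ _ _ F hF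
    exact contDiff_zero.2
      (intervalIntegral.continuous_parametric_intervalIntegral_of_continuous' hF.continuous 0 1)
  | succ n ih =>
    intro V W _ _ _ _ _ F hF
    set F' : V → ℝ → V →L[ℝ] W := fun x t =>
      (fderiv ℝ (fun p : V × ℝ => F p.1 p.2) (x, t)).comp (ContinuousLinearMap.inl ℝ V ℝ) with hF'
    have hF's : ContDiff ℝ ∞ (fun p : V × ℝ => F' p.1 p.2) := by
      have h1 : ContDiff ℝ ∞ (fderiv ℝ (fun p : V × ℝ => F p.1 p.2)) :=
        hF.fderiv_right (by simp)
      exact h1.clm_comp contDiff_const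
    rw [Nat.cast_succ, contDiff_succ_iff_hasFDerivAt]
    refine ⟨fun x => ∫ t in (0 : ℝ)..1, F' x t, ih F' hF's, fun x => ?_⟩
    have hK : IsCompact (Metric.closedBall x 1 ×ˢ Set.Icc (0 : ℝ) 1) :=
      (isCompact_closedBall x 1).prod isCompact_Icc
    obtain ⟨C, hC⟩ := hK.exists_bound_of_continuousOn hF's.continuous.continuousOn
    have hcont : ∀ y, Continuous (F y) := fun y =>
      hF.continuous.comp (continuous_const.prodMk continuous_id)
    have hcont' : ∀ y, Continuous (F' y) := fun y =>
      hF's.continuous.comp (continuous_const.prodMk continuous_id)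
    refine intervalIntegral.hasFDerivAt_integral_of_dominated_of_fderiv_le
      (bound := fun _ => C) (Metric.closedBall_mem_nhds x one_pos)
      (Filter.Eventually.of_forall fun y => (hcont y).aestronglyMeasurable)
      ((hcont x).intervalIntegrable 0 1) (hcont' x).aestronglyMeasurable
      (Filter.Eventually.of_forall fun t ht y hy => ?_) (by simp)
      (Filter.Eventually.of_forall fun t _ y _ => ?_)
    · rw [Set.uIoc_of_le zero_le_one] at ht
      exact hC (y, t) ⟨hy, ht.1.le, ht.2⟩
    · have h1 : HasFDerivAt (fun p : V × ℝ => F p.1 p.2) _ (y, t) :=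
        (hF.differentiable (by simp) (y, t)).hasFDerivAt
      have h2 : HasFDerivAt (fun v : V => (v, t)) (ContinuousLinearMap.inl ℝ V ℝ) y :=
        hasFDerivAt_prodMk_left y t
      exact HasFDerivAt.comp (g := fun p : V × ℝ => F p.1 p.2) y h1 h2

theorem hadamard {n : ℕ} (f : SmoothFn n) : ∃ g : Fin n → Cart n × Cart n → ℝ,
    (∀ i, ContDiff ℝ ∞ (g i)) ∧
      ∀ x y, f x - f y = ∑ i, (x i - y i) * g i (x, y) := by
  have hf : ContDiff ℝ ∞ f := f.contMDiff.contDiff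
  have hf' : ContDiff ℝ ∞ (fderiv ℝ f) := hf.fderiv_right (by simp)
  refine ⟨fun i p => ∫ t in (0 : ℝ)..1,
    fderiv ℝ f (p.2 + t • (p.1 - p.2)) (Pi.single i 1), fun i => ?_, fun x y => ?_⟩
  · refine contDiff_infty.2 fun k => contDiff_integral_nat k
      (fun (p : Cart n × Cart n) t => fderiv ℝ f (p.2 + t • (p.1 - p.2)) (Pi.single i 1)) ?_
    exact (hf'.comp (by fun_prop)).clm_apply contDiff_const
  · have hder : ∀ t : ℝ, HasDerivAt (fun t : ℝ => f (y + t • (x - y)))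
        (fderiv ℝ f (y + t • (x - y)) (x - y)) t := by
      intro t
      have h1 : HasDerivAt (fun t : ℝ => y + t • (x - y)) (x - y) t := by
        simpa using ((hasDerivAt_id t).smul_const (x - y)).const_add y
      exact (hf.differentiable (by simp) _).hasFDerivAt.comp_hasDerivAt t h1
    have hc : ∀ v : Cart n, Continuous fun t : ℝ => fderiv ℝ f (y + t • (x - y)) v := fun v =>
      (hf'.continuous.comp (by fun_prop)).clm_apply continuous_const
    have h2 := intervalIntegral.integral_eq_sub_of_hasDerivAt (a := 0) (b := 1)
      (fun t _ => hder t) ((hc _).intervalIntegrable 0 1)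
    simp only [one_smul, zero_smul, add_zero, add_sub_cancel] at h2
    rw [← h2]
    have hexp : x - y = ∑ i, (x i - y i) • (Pi.single i (1 : ℝ) : Cart n) := by
      simpa using pi_eq_sum_univ' (x - y)
    have h3 : ∀ t : ℝ, fderiv ℝ f (y + t • (x - y)) (x - y) =
        ∑ i, (x i - y i) * fderiv ℝ f (y + t • (x - y)) (Pi.single i 1) := by
      intro t
      generalize fderiv ℝ f (y + t • (x - y)) = L
      conv_lhs => rw [hexp]
      simp only [map_sum, map_smul, smul_eq_mul]
    simp only [h3]
    rw [intervalIntegral.integral_finsetSum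
      (fun i _ => ((hc _).const_mul _).intervalIntegrable 0 1)]
    simp only [intervalIntegral.integral_const_mul]

section Quotient

variable {E : Type*} [NormedAddCommGroup E] [NormedSpace ℝ E] {H : Type*} [TopologicalSpace H]
  {I : ModelWithCorners ℝ E H} {M : Type*} [TopologicalSpace M] [ChartedSpace H M]

theorem op_sub_mem (J : Ideal C^∞⟮I, M; 𝓘(ℝ, ℝ), ℝ⟯) {n : ℕ} (f : SmoothFn n)
    (a b : Fin n → C^∞⟮I, M; 𝓘(ℝ, ℝ), ℝ⟯) (h : ∀ i, a i - b i ∈ J) :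
    f.comp (tuple a) - f.comp (tuple b) ∈ J := by
  obtain ⟨g, hg, hfg⟩ := hadamard f
  let G : Fin n → C^∞⟮I, M; 𝓘(ℝ, ℝ), ℝ⟯ := fun i =>
    ⟨fun x => g i (tuple a x, tuple b x),
      (hg i).contMDiff.comp ((tuple a).contMDiff.prodMk_space (tuple b).contMDiff)⟩
  have key : f.comp (tuple a) - f.comp (tuple b) = ∑ i, (a i - b i) * G i := by
    ext x
    have hs : (∑ i, (a i - b i) * G i) x = ∑ i, ((a i - b i) * G i) x :=
      map_sum (ContMDiffMap.evalRingHom (I := I) (I' := 𝓘(ℝ, ℝ)) (R := ℝ) (n := ∞) x) _ _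
    rw [hs]
    exact hfg (tuple a x) (tuple b x)
  rw [key]
  exact J.sum_mem fun i _ => J.mul_mem_right _ (h i)

/-- The operation of `f` on a quotient `C^∞(M)/J`, computed on representatives. -/
def quotientOp (J : Ideal C^∞⟮I, M; 𝓘(ℝ, ℝ), ℝ⟯) {n : ℕ} (f : SmoothFn n)
    (a : Fin n → C^∞⟮I, M; 𝓘(ℝ, ℝ), ℝ⟯ ⧸ J) : C^∞⟮I, M; 𝓘(ℝ, ℝ), ℝ⟯ ⧸ J :=
  Ideal.Quotient.mk J (f.comp (tuple fun i => (Ideal.Quotient.mk_surjective (a i)).choose))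

theorem quotientOp_mk (J : Ideal C^∞⟮I, M; 𝓘(ℝ, ℝ), ℝ⟯) {n : ℕ} (f : SmoothFn n)
    (a : Fin n → C^∞⟮I, M; 𝓘(ℝ, ℝ), ℝ⟯) (b : Fin n → C^∞⟮I, M; 𝓘(ℝ, ℝ), ℝ⟯ ⧸ J)
    (h : ∀ i, b i = Ideal.Quotient.mk J (a i)) :
    quotientOp J f b = Ideal.Quotient.mk J (f.comp (tuple a)) := by
  refine Ideal.Quotient.eq.2 (op_sub_mem J f _ _ fun i => Ideal.Quotient.eq.1 ?_)
  exact (Ideal.Quotient.mk_surjective (b i)).choose_spec.trans (h i)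

/-- The `C^∞`-algebra structure on `C^∞(M)/J`; the projection from `C^∞(M)` is a `C^∞`-map. -/
instance (J : Ideal C^∞⟮I, M; 𝓘(ℝ, ℝ), ℝ⟯) : CInftyAlgebra (C^∞⟮I, M; 𝓘(ℝ, ℝ), ℝ⟯ ⧸ J) where
  op f a := quotientOp J f a
  op_coord i b := by
    choose a ha using fun i => Ideal.Quotient.mk_surjective (b i)
    rw [quotientOp_mk J _ a b fun i => (ha i).symm, ← ha i]
    rfl
  op_comp f g b := by
    choose a ha using fun i => Ideal.Quotient.mk_surjective (b i)
    rw [quotientOp_mk J _ a b fun i => (ha i).symm,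
      quotientOp_mk J f (fun j => (g j).comp (tuple a)) _
        fun j => quotientOp_mk J (g j) a b fun i => (ha i).symm]
    rfl
  op_add x y := by
    obtain ⟨x, rfl⟩ := Ideal.Quotient.mk_surjective x
    obtain ⟨y, rfl⟩ := Ideal.Quotient.mk_surjective y
    rw [quotientOp_mk J _ ![x, y] _ (by intro i; fin_cases i <;> rfl)]
    rfl
  op_mul x y := by
    obtain ⟨x, rfl⟩ := Ideal.Quotient.mk_surjective x
    obtain ⟨y, rfl⟩ := Ideal.Quotient.mk_surjective y
    rw [quotientOp_mk J _ ![x, y] _ (by intro i; fin_cases i <;> rfl)]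
    rfl
  op_const r := by
    rw [quotientOp_mk J _ ![] _ (fun i => i.elim0)]
    rfl

end Quotient

/-! ### The category of `C^∞`-algebras -/

/-- A bundled `C^∞`-algebra. -/
structure CInftyAlgCat where
  carrier : Type
  [commRing : CommRing carrier]
  [algebra : Algebra ℝ carrier]
  [cinfty : CInftyAlgebra carrier]

namespace CInftyAlgCat

attribute [instance] commRing algebra cinfty

/-- The bundled `C^∞`-algebra on a given type. -/
abbrev of (A : Type) [CommRing A] [Algebra ℝ A] [CInftyAlgebra A] : CInftyAlgCat := ⟨A⟩

/-- A `C^∞`-algebra homomorphism. -/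
@[ext]
structure Hom (A B : CInftyAlgCat) where
  hom : A.carrier →ₐ[ℝ] B.carrier
  isCInftyHom : IsCInftyHom hom

instance : Category CInftyAlgCat where
  Hom A B := Hom A B
  id A := ⟨AlgHom.id ℝ A.carrier, fun _ _ => rfl⟩
  comp f g := ⟨g.hom.comp f.hom, fun h a => by
    simp only [AlgHom.comp_apply]; rw [f.isCInftyHom, g.isCInftyHom]⟩

/-- The functor sending a `C^∞`-algebra to its underlying `ℝ`-algebra. -/
def forgetToAlg : CInftyAlgCat ⥤ CommAlgCat.{0} ℝ where
  obj A := CommAlgCat.of ℝ A.carrier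
  map f := CommAlgCat.ofHom f.hom

end CInftyAlgCat

/-! ### Weil algebras and the two kinds of thickened Cartesian spaces -/

/-- `W` is a Weil algebra: a nonzero algebra `W = ℝ·1 ⊕ V`, with `V` finite-dimensional and
consisting of nilpotent elements. -/
def IsWeilAlgebra (W : Type) [CommRing W] [Algebra ℝ W] : Prop :=
  Nontrivial W ∧ ∃ V : Submodule ℝ W,
    IsCompl (Submodule.span ℝ {(1 : W)}) V ∧ FiniteDimensional ℝ V ∧ ∀ v ∈ V, IsNilpotent v

/-- The `ℝ`-algebras of the form `C^∞(ℝᵏ) ⊗_ℝ W` with `W` a Weil algebra. -/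
def IsThickenedAlg : ObjectProperty (CommAlgCat.{0} ℝ) := fun A =>
  ∃ (k : ℕ) (W : Type) (_ : CommRing W) (_ : Algebra ℝ W),
    IsWeilAlgebra W ∧ Nonempty ((SmoothFn k ⊗[ℝ] W) ≃ₐ[ℝ] A)

/-- `A`, with the given maps from `B` and `W`, is the tensor product `B ⊗_∞ W` of `C^∞`-algebras,
that is, their coproduct in the category of `C^∞`-algebras. -/
def IsCInftyTensor {B W A : CInftyAlgCat} (inl : B ⟶ A) (inr : W ⟶ A) : Prop :=
  Nonempty (IsColimit (BinaryCofan.mk inl inr))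

/-- The `C^∞`-algebras of the form `C^∞(ℝᵏ) ⊗_∞ W` with `W` a Weil algebra. -/
def IsThickenedCInftyAlg : ObjectProperty CInftyAlgCat := fun A =>
  ∃ (k : ℕ) (W : CInftyAlgCat) (inl : CInftyAlgCat.of (SmoothFn k) ⟶ A) (inr : W ⟶ A),
    IsWeilAlgebra W.carrier ∧ IsCInftyTensor inl inr

/-- The category `ThCartSp` of thickened Cartesian spaces, with all `ℝ`-algebra maps. -/
abbrev ThCartSp : Type 1 := (IsThickenedAlg.FullSubcategory)ᵒᵖ

/-- The category of thickened Cartesian spaces with `C^∞`-algebra maps. -/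
abbrev CInftyThCartSp : Type 1 := (IsThickenedCInftyAlg.FullSubcategory)ᵒᵖ

/-! ### Good open covers and sheaves -/

/-- A (differentiably) good open cover of `ℝᵏ`: every nonempty finite intersection of members is
diffeomorphic to `ℝᵏ`. -/
def IsGoodOpenCover {k : ℕ} {ι : Type} (U : ι → Opens (Cart k)) : Prop :=
  (⨆ i, U i = ⊤) ∧ ∀ s : Finset ι, s.Nonempty → s.inf U ≠ ⊥ →
    Nonempty ((s.inf U : Opens (Cart k)) ≃ₘ⟮𝓘(ℝ, Cart k), 𝓘(ℝ, Cart k)⟯ Cart k)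

/-- The family `f i : Y i ⟶ X` in `ThCartSp` is, up to isomorphism, of the form
`U i × 𝔻 ⟶ ℝᵏ × 𝔻` for a good open cover `U` of `ℝᵏ`. -/
def IsGoodCover {X : ThCartSp} {ι : Type} (Y : ι → ThCartSp) (f : ∀ i, Y i ⟶ X) : Prop :=
  ∃ (k : ℕ) (W : Type) (_ : CommRing W) (_ : Algebra ℝ W) (U : ι → Opens (Cart k))
    (e : (SmoothFn k ⊗[ℝ] W) ≃ₐ[ℝ] X.unop.obj)
    (e' : ∀ i, (SmoothFnOn (U i) ⊗[ℝ] W) ≃ₐ[ℝ] (Y i).unop.obj),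
    IsWeilAlgebra W ∧ IsGoodOpenCover U ∧
      ∀ i, ((f i).unop.hom.hom : X.unop.obj →ₐ[ℝ] (Y i).unop.obj).comp e.toAlgHom =
        (e' i).toAlgHom.comp (Algebra.TensorProduct.map (restrict (U i)) (AlgHom.id ℝ W))

/-- Restriction to an open subset as a map of `C^∞`-algebras. -/
def restrictHom {k : ℕ} (U : Opens (Cart k)) :
    CInftyAlgCat.of (SmoothFn k) ⟶ CInftyAlgCat.of (SmoothFnOn U) :=
  CInftyAlgCat.Hom.mk (restrict U) fun _ _ => rfl

/-- The family `f i : Y i ⟶ X` of thickened Cartesian spaces and `C^∞`-algebra maps is, up to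
isomorphism, of the form `U i × 𝔻 ⟶ ℝᵏ × 𝔻` for a good open cover `U` of `ℝᵏ`; the function
algebras are `C^∞(ℝᵏ) ⊗_∞ W` and `C^∞(U i) ⊗_∞ W`, and `f i` is `restriction ⊗_∞ id`. -/
def IsCInftyGoodCover {X : CInftyThCartSp} {ι : Type} (Y : ι → CInftyThCartSp)
    (f : ∀ i, Y i ⟶ X) : Prop :=
  ∃ (k : ℕ) (W : CInftyAlgCat) (U : ι → Opens (Cart k))
    (inl : CInftyAlgCat.of (SmoothFn k) ⟶ X.unop.obj) (inr : W ⟶ X.unop.obj)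
    (inl' : ∀ i, CInftyAlgCat.of (SmoothFnOn (U i)) ⟶ (Y i).unop.obj)
    (inr' : ∀ i, W ⟶ (Y i).unop.obj),
    IsWeilAlgebra W.carrier ∧ IsGoodOpenCover U ∧ IsCInftyTensor inl inr ∧
      ∀ i, IsCInftyTensor (inl' i) (inr' i) ∧
        inl ≫ (f i).unop.hom = restrictHom (U i) ≫ inl' i ∧ inr ≫ (f i).unop.hom = inr' i

/-- The good open coverage on `ThCartSp`. -/
def goodCoverage : Precoverage ThCartSp where
  coverings X := {R | ∃ (ι : Type) (Y : ι → ThCartSp) (f : ∀ i, Y i ⟶ X),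
    R = Presieve.ofArrows Y f ∧ IsGoodCover Y f}

/-- The good open coverage on `CInftyThCartSp`. -/
def cinftyGoodCoverage : Precoverage CInftyThCartSp where
  coverings X := {R | ∃ (ι : Type) (Y : ι → CInftyThCartSp) (f : ∀ i, Y i ⟶ X),
    R = Presieve.ofArrows Y f ∧ IsCInftyGoodCover Y f}

/-- Thickened smooth sets: sheaves of sets on `ThCartSp` for the good open coverage. -/
abbrev ThSmoothSet := Sheaf goodCoverage.toGrothendieck Type

/-- The Cahiers topos: sheaves of sets on `CInftyThCartSp` for the good open coverage. -/
abbrev CahiersTopos := Sheaf cinftyGoodCoverage.toGrothendieck Type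

/-! ### Presentations -/

/-- `q` presents `W` as the quotient of `ℝ[y₁, …, y_m]` by an ideal containing some power of
`(y₁, …, y_m)`, i.e. as a quotient of the function algebra `ℝ[y]/(y)^(l+1)` of an infinitesimal
disk. -/
def IsDiskPresentation {W : Type} [CommRing W] [Algebra ℝ W] {m : ℕ}
    (q : MvPolynomial (Fin m) ℝ →ₐ[ℝ] W) : Prop :=
  Function.Surjective q ∧ ∃ l : ℕ,
    (Ideal.span (Set.range (MvPolynomial.X : Fin m → MvPolynomial (Fin m) ℝ))) ^ (l + 1) ≤
      RingHom.ker q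

/-- The projection `ℝᵏ⁺ᵐ → ℝᵏ`. -/
def projX (k m : ℕ) : C^∞⟮𝓘(ℝ, Cart (k + m)), Cart (k + m); 𝓘(ℝ, Cart k), Cart k⟯ :=
  tuple fun i => coord (Fin.castAdd m i)

/-- The projection `ℝᵏ⁺ᵐ → ℝᵐ`. -/
def projY (k m : ℕ) : C^∞⟮𝓘(ℝ, Cart (k + m)), Cart (k + m); 𝓘(ℝ, Cart m), Cart m⟯ :=
  tuple fun j => coord (Fin.natAdd k j)

/-- The ideal of `C^∞(ℝᵏ⁺ᵐ)` generated by the polynomials `p(y)` with `p ∈ ker q`. -/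
def liftedIdeal (k : ℕ) {W : Type} [CommRing W] [Algebra ℝ W] {m : ℕ}
    (q : MvPolynomial (Fin m) ℝ →ₐ[ℝ] W) : Ideal (SmoothFn (k + m)) :=
  Ideal.span {h | ∃ p, q p = 0 ∧ h = pullback (projY k m) (polyFn m p)}

/-- The ideal of `C^∞(ℝⁿ)` generated by finitely many polynomials. -/
def polyIdeal {n r : ℕ} (p : Fin r → MvPolynomial (Fin n) ℝ) : Ideal (SmoothFn n) :=
  Ideal.span (Set.range fun j => polyFn n (p j))

end Cahiers

end

/-!
# Thickened Cartesian spaces as `ℝ`-algebras and as `C^∞`-algebras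

Every `ℝ`-algebra map from a `C^∞`-algebra to `C^∞(ℝᵏ) ⊗ W`, for `W` a Weil algebra, automatically
commutes with all smooth operations. The reason is that `ℝ`-algebra maps
`C^∞(ℝⁿ) → C^∞(ℝᵏ) ⊗ W` are determined by the images of the coordinate functions
(`CoordDetermined`): given `φ : A → B` and `a : Fin n → A`, one compares the two `ℝ`-algebra maps
`f ↦ φ (f(a))` and `f ↦ f(φ ∘ a)`. By evaluation at the points of `ℝᵏ` it is enough to treat maps
`φ : C^∞(ℝⁿ) → W`. Such a map sends the coordinates to `xᵢ + nilpotent` for some real `xᵢ`, so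
it kills a power of the ideal generated by the `coord i - xᵢ`; iterating Hadamard's lemma shows that
modulo such a power every smooth function is a polynomial
(`IsWeilAlgebra.coordDetermined`, `coordDetermined_tensor`).

It follows that the `C^∞`-structure on a thickened algebra is unique. It exists because
`C^∞(ℝᵏ) ⊗ W ≅ C^∞(ℝᵏ⁺ᵐ)/Ĩ` (`thickEquiv`). Surjectivity is Hadamard's lemma in the variables `y`.
For injectivity, the presentation `ℝ[y] → W` is extended to `C^∞(ℝᵐ) → W`
(`IsDiskPresentation.exists_smooth_extension`): a polynomial in the `N`-th power of the ideal of the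
origin in `C^∞(ℝᵐ)` is `O(tᴺ)` along every line, hence has no terms of degree below `N`. Restriction
to the fibres `{x} × ℝᵐ` then recovers all the values of an element of `C^∞(ℝᵏ) ⊗ W`.

Since `C^∞(ℝⁿ)` is the free `C^∞`-algebra on its coordinates, the same isomorphism shows that
`C^∞(ℝᵏ) ⊗_ℝ W` is the coproduct `C^∞(ℝᵏ) ⊗_∞ W` (`isCInftyTensor_iff_bijective`). The two notions
of thickened Cartesian space and of good open cover therefore agree; a nonempty member of a good open
cover is diffeomorphic to `ℝᵏ`, and empty members do not occur because thickened algebras are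
nontrivial. The forgetful functor is bijective on objects and fully faithful, and an isomorphism of
categories that matches the coverages induces an equivalence of sheaf categories.
-/

namespace Cahiers

/-! ### Algebra homomorphisms determined by their values on coordinates -/

section CInftyAlgebra

variable {A : Type*} [CommRing A] [Algebra ℝ A] [CInftyAlgebra A]

/-- The `ℝ`-algebra map `f ↦ f(a₁, …, aₙ)` on the free `C^∞`-algebra `C^∞(ℝⁿ)`. -/
noncomputable def opHom {n : ℕ} (a : Fin n → A) : SmoothFn n →ₐ[ℝ] A :=
  have h_add (f g : SmoothFn n) :
      CInftyAlgebra.op (f + g) a = CInftyAlgebra.op f a + CInftyAlgebra.op g a := by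
    have h : f + g = (coord (0 : Fin 2) + coord 1).comp (tuple ![f, g]) := rfl
    rw [h, CInftyAlgebra.op_comp]
    refine (congrArg _ (funext fun j => ?_)).trans (CInftyAlgebra.op_add _ _)
    fin_cases j <;> rfl
  have h_mul (f g : SmoothFn n) :
      CInftyAlgebra.op (f * g) a = CInftyAlgebra.op f a * CInftyAlgebra.op g a := by
    have h : f * g = (coord (0 : Fin 2) * coord 1).comp (tuple ![f, g]) := rfl
    rw [h, CInftyAlgebra.op_comp]
    refine (congrArg _ (funext fun j => ?_)).trans (CInftyAlgebra.op_mul _ _)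
    fin_cases j <;> rfl
  have h_const (r : ℝ) :
      CInftyAlgebra.op (algebraMap ℝ (SmoothFn n) r) a = algebraMap ℝ A r := by
    have h : algebraMap ℝ (SmoothFn n) r =
        ContMDiffMap.comp (ContMDiffMap.const r : SmoothFn 0) (tuple ![]) := rfl
    rw [h, CInftyAlgebra.op_comp, ← CInftyAlgebra.op_const]
    congr 1
    funext j
    exact j.elim0
  { toFun := fun f => CInftyAlgebra.op f a
    map_one' := by simpa using h_const 1
    map_mul' := h_mul
    map_zero' := by simpa using h_const 0
    map_add' := h_add
    commutes' := h_const }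

theorem opHom_coord {n : ℕ} (a : Fin n → A) (i : Fin n) : opHom a (coord i) = a i :=
  CInftyAlgebra.op_coord i a

/-- `C^∞(ℝⁿ)` is free: evaluation at `a` is compatible with all smooth operations. -/
theorem isCInftyHom_opHom {n : ℕ} (a : Fin n → A) : IsCInftyHom (opHom a) :=
  fun f g => CInftyAlgebra.op_comp f g a

/-- A `C^∞`-map out of `C^∞(ℝⁿ)` is evaluation at the images of the coordinates. -/
theorem IsCInftyHom.eq_opHom {n : ℕ} {φ : SmoothFn n →ₐ[ℝ] A} (hφ : IsCInftyHom φ) :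
    φ = opHom fun i => φ (coord i) := by
  ext f
  exact hφ f coord

end CInftyAlgebra

/-- `ℝ`-algebra maps from any `C^∞(ℝⁿ)` to `B` are determined by the images of the coordinate
functions. -/
def CoordDetermined (B : Type*) [CommRing B] [Algebra ℝ B] : Prop :=
  ∀ (n : ℕ) (φ ψ : SmoothFn n →ₐ[ℝ] B), (∀ i, φ (coord i) = ψ (coord i)) → φ = ψ

namespace CoordDetermined

variable {A B : Type*} [CommRing A] [Algebra ℝ A] [CommRing B] [Algebra ℝ B]

/-- For `a : Fin n → A`, the maps `f ↦ φ (f(a))` and `f ↦ f(φ ∘ a)` are `ℝ`-algebra maps from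
`C^∞(ℝⁿ)` with the same values on coordinates. -/
theorem isCInftyHom (hB : CoordDetermined B) [CInftyAlgebra A] [CInftyAlgebra B] (φ : A →ₐ[ℝ] B) :
    IsCInftyHom φ := fun f a => by
  have h : φ.comp (opHom a) = opHom fun i => φ (a i) :=
    hB _ _ _ fun i => by simp [opHom_coord]
  exact DFunLike.congr_fun h f

theorem subsingleton (hB : CoordDetermined B) : Subsingleton (CInftyAlgebra B) := by
  refine ⟨fun s t => ?_⟩
  have h : ∀ {n : ℕ} (f : SmoothFn n) (a : Fin n → B), s.op f a = t.op f a :=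
    @isCInftyHom B B _ _ _ _ hB s t (AlgHom.id ℝ B)
  obtain ⟨op₁⟩ := s
  obtain ⟨op₂⟩ := t
  obtain rfl : @op₁ = @op₂ := by
    funext n f a
    exact h f a
  rfl

/-- It suffices to have a jointly injective family of maps to algebras with the property. -/
theorem of_jointly_injective {ι : Type*} {C : Type*} [CommRing C] [Algebra ℝ C]
    (hC : CoordDetermined C) (ev : ι → B →ₐ[ℝ] C)
    (hev : ∀ b, (∀ i, ev i b = 0) → b = 0) : CoordDetermined B := fun n φ ψ h => by
  ext f
  refine sub_eq_zero.1 (hev _ fun i => ?_)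
  rw [map_sub, sub_eq_zero]
  exact DFunLike.congr_fun (hC n ((ev i).comp φ) ((ev i).comp ψ) fun j => by simp [h j]) f

theorem of_algEquiv (hA : CoordDetermined A) (e : A ≃ₐ[ℝ] B) : CoordDetermined B :=
  hA.of_jointly_injective (fun _ : Unit => e.symm.toAlgHom) fun b hb => by
    simpa using hb ()

end CoordDetermined

/-! ### Polynomial approximation modulo powers of an ideal -/

/-- If every element is congruent to an element of the subring `S` modulo an ideal generated by
elements of `S`, then the same holds modulo all powers of the ideal. -/
theorem exists_mem_sub_mem_span_pow {A : Type*} [CommRing A] (S : Subring A) {s : Set A}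
    (hs : s ⊆ S) (h : ∀ a, ∃ b ∈ S, a - b ∈ Ideal.span s) (N : ℕ) :
    ∀ a, ∃ b ∈ S, a - b ∈ Ideal.span s ^ N := by
  induction N with
  | zero => exact fun a => ⟨0, S.zero_mem, by simp⟩
  | succ N ih =>
    -- the approximation is kept in the ideal, so that an error in a coefficient gains one power
    have key : ∀ x ∈ Ideal.span s, ∃ c ∈ S, c ∈ Ideal.span s ∧ x - c ∈ Ideal.span s ^ (N + 1) := by
      intro x hx
      induction hx using Submodule.span_induction with
      | mem x hx => exact ⟨x, hs hx, Ideal.subset_span hx, by simp⟩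
      | zero => exact ⟨0, S.zero_mem, zero_mem _, by simp⟩
      | add x y _ _ hx hy =>
        obtain ⟨c, hc, hc', hxc⟩ := hx
        obtain ⟨d, hd, hd', hyd⟩ := hy
        refine ⟨c + d, S.add_mem hc hd, add_mem hc' hd', ?_⟩
        rw [add_sub_add_comm]
        exact add_mem hxc hyd
      | smul a x _ hx =>
        obtain ⟨c, hc, hc', hxc⟩ := hx
        obtain ⟨b, hb, hab⟩ := ih a
        refine ⟨b * c, S.mul_mem hb hc, Ideal.mul_mem_left _ _ hc', ?_⟩
        have h1 : a • x - b * c = a * (x - c) + (a - b) * c := by rw [smul_eq_mul]; ring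
        rw [h1]
        rw [pow_succ] at hxc ⊢
        exact add_mem (Ideal.mul_mem_left _ _ hxc) (Ideal.mul_mem_mul hab hc')
    intro a
    obtain ⟨b, hb, hab⟩ := h a
    obtain ⟨c, hc, -, hc'⟩ := key _ hab
    exact ⟨b + c, S.add_mem hb hc, by rwa [← sub_sub]⟩

theorem coord_apply {n : ℕ} (i : Fin n) (x : Cart n) : coord i x = x i := rfl

theorem polyFn_X {n : ℕ} (i : Fin n) : polyFn n (MvPolynomial.X i) = coord i :=
  MvPolynomial.aeval_X _ _

theorem polyFn_C {n : ℕ} (r : ℝ) : polyFn n (MvPolynomial.C r) = algebraMap ℝ _ r :=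
  MvPolynomial.aeval_C _ _

section Eval

variable {E : Type*} [NormedAddCommGroup E] [NormedSpace ℝ E] {H : Type*} [TopologicalSpace H]
  {I : ModelWithCorners ℝ E H} {M : Type*} [TopologicalSpace M] [ChartedSpace H M]

/-- Evaluation of smooth functions at a point, as an `ℝ`-algebra map. -/
noncomputable def evalAt (x : M) : C^∞⟮I, M; 𝓘(ℝ, ℝ), ℝ⟯ →ₐ[ℝ] ℝ where
  toFun f := f x
  map_one' := rfl
  map_mul' _ _ := rfl
  map_zero' := rfl
  map_add' _ _ := rfl
  commutes' _ := rfl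

theorem evalAt_apply (x : M) (f : C^∞⟮I, M; 𝓘(ℝ, ℝ), ℝ⟯) : evalAt x f = f x := rfl

/-- Hadamard's lemma for functions pulled back along two smooth maps into `ℝⁿ`. -/
theorem comp_sub_comp_mem {n : ℕ} (f : SmoothFn n)
    (a b : Fin n → C^∞⟮I, M; 𝓘(ℝ, ℝ), ℝ⟯) :
    f.comp (tuple a) - f.comp (tuple b) ∈ Ideal.span (Set.range fun i => a i - b i) :=
  op_sub_mem _ f a b fun i => Ideal.subset_span ⟨i, rfl⟩

end Eval

theorem polyFn_apply {n : ℕ} (p : MvPolynomial (Fin n) ℝ) (x : Cart n) :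
    polyFn n p x = MvPolynomial.eval x p := by
  have h : (evalAt x).comp (polyFn n) = MvPolynomial.aeval x := by
    ext i
    simp [polyFn_X, evalAt_apply, coord_apply]
  exact (DFunLike.congr_fun h p).trans (by rw [MvPolynomial.aeval_eq_eval])

/-- Taylor's formula without derivatives: modulo any power of the ideal of functions vanishing
at `x`, a smooth function is a polynomial. -/
theorem exists_polyFn_sub_mem_pow {n : ℕ} (x : Cart n) (N : ℕ) (f : SmoothFn n) :
    ∃ p, f - polyFn n p ∈
      Ideal.span (Set.range fun i => coord i - algebraMap ℝ (SmoothFn n) (x i)) ^ N := by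
  have hs : (Set.range fun i => coord i - algebraMap ℝ (SmoothFn n) (x i)) ⊆
      (polyFn n).range.toSubring := by
    rintro _ ⟨i, rfl⟩
    exact ⟨MvPolynomial.X i - MvPolynomial.C (x i), by simp [polyFn_X]⟩
  have h0 (g : SmoothFn n) : ∃ b ∈ (polyFn n).range.toSubring,
      g - b ∈ Ideal.span (Set.range fun i => coord i - algebraMap ℝ (SmoothFn n) (x i)) :=
    ⟨polyFn n (MvPolynomial.C (g x)), ⟨_, rfl⟩, by
      rw [polyFn_C]
      exact comp_sub_comp_mem g coord fun i => algebraMap ℝ (SmoothFn n) (x i)⟩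
  obtain ⟨_, ⟨p, rfl⟩, h⟩ := exists_mem_sub_mem_span_pow _ hs h0 N f
  exact ⟨p, h⟩

/-! ### Weil algebras -/

namespace IsWeilAlgebra

variable {W : Type} [CommRing W] [Algebra ℝ W]

theorem exists_sub_algebraMap_mem_nilradical (hW : IsWeilAlgebra W) (w : W) :
    ∃ r : ℝ, w - algebraMap ℝ W r ∈ nilradical W := by
  obtain ⟨-, V, hV, -, hnil⟩ := hW
  obtain ⟨a, ha, v, hv, rfl⟩ := Submodule.mem_sup.1 (hV.sup_eq_top.ge (Submodule.mem_top (x := w)))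
  obtain ⟨r, rfl⟩ := Submodule.mem_span_singleton.1 ha
  exact ⟨r, by rw [Algebra.algebraMap_eq_smul_one, add_sub_cancel_left]; exact hnil v hv⟩

theorem finite (hW : IsWeilAlgebra W) : Module.Finite ℝ W := by
  obtain ⟨-, V, hV, hfin, -⟩ := hW
  refine ⟨?_⟩
  rw [← hV.sup_eq_top]
  exact (Submodule.fg_span_singleton _).sup (Module.Finite.iff_fg.1 hfin)

/-- The exponent is taken positive, as in `IsDiskPresentation`. -/
theorem exists_nilradical_pow (hW : IsWeilAlgebra W) : ∃ N : ℕ, nilradical W ^ (N + 1) = ⊥ := by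
  have := hW.finite
  have : IsNoetherianRing W := isNoetherian_of_tower ℝ inferInstance
  obtain ⟨N, hN⟩ := IsNoetherianRing.isNilpotent_nilradical W
  exact ⟨N, by rw [pow_succ, hN]; simp⟩

/-- A map `φ : C^∞(ℝⁿ) → W` sends the `i`-th coordinate to `xᵢ` plus a nilpotent element, so it
kills a power of the ideal of the point `x`, modulo which every function is a polynomial. -/
theorem coordDetermined (hW : IsWeilAlgebra W) : CoordDetermined W := by
  intro n φ ψ h
  obtain ⟨N, hN⟩ := hW.exists_nilradical_pow
  choose x hx using fun i => hW.exists_sub_algebraMap_mem_nilradical (φ (coord i))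
  have kill : ∀ χ : SmoothFn n →ₐ[ℝ] W, (∀ i, χ (coord i) = φ (coord i)) →
      ∀ f ∈ Ideal.span (Set.range fun i => coord i - algebraMap ℝ (SmoothFn n) (x i)) ^ (N + 1),
        χ f = 0 := by
    intro χ hχ f hf
    have h1 : Ideal.span (Set.range fun i => coord i - algebraMap ℝ (SmoothFn n) (x i)) ≤
        (nilradical W).comap χ := by
      rw [Ideal.span_le]
      rintro _ ⟨i, rfl⟩
      have := hx i
      rw [← hχ] at this
      simpa using this
    have h2 := Ideal.le_comap_pow χ (N + 1) (Ideal.pow_right_mono h1 (N + 1) hf)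
    rwa [hN] at h2
  have hpoly : φ.comp (polyFn n) = ψ.comp (polyFn n) := by
    ext i
    simpa [polyFn_X] using h i
  ext f
  obtain ⟨p, hp⟩ := exists_polyFn_sub_mem_pow x (N + 1) f
  have h1 := kill φ (fun _ => rfl) _ hp
  have h2 := kill ψ (fun i => (h i).symm) _ hp
  rw [map_sub, sub_eq_zero] at h1 h2
  rw [h1, h2]
  exact DFunLike.congr_fun hpoly p

/-- The generators are sent to a basis of a complement of `ℝ · 1` consisting of nilpotents. -/
theorem exists_isDiskPresentation (hW : IsWeilAlgebra W) :
    ∃ (m : ℕ) (q : MvPolynomial (Fin m) ℝ →ₐ[ℝ] W), IsDiskPresentation q := by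
  obtain ⟨N, hN⟩ := hW.exists_nilradical_pow
  obtain ⟨-, V, hV, hfin, hnil⟩ := hW
  let b := Module.finBasis ℝ V
  refine ⟨_, MvPolynomial.aeval fun i => (b i : W), ?_, N, ?_⟩
  · rw [← AlgHom.range_eq_top, ← Algebra.toSubmodule_eq_top, eq_top_iff, ← hV.sup_eq_top,
      sup_le_iff]
    constructor
    · rw [Submodule.span_le, Set.singleton_subset_iff]
      exact one_mem (AlgHom.range _)
    · have : V = Submodule.span ℝ (Set.range fun i => (b i : W)) := by
        have h := congrArg (Submodule.map V.subtype) b.span_eq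
        rw [Submodule.map_span, ← Set.range_comp, Submodule.map_top, Submodule.range_subtype] at h
        exact h.symm
      refine this.trans_le (Submodule.span_le.2 ?_)
      rintro _ ⟨i, rfl⟩
      exact ⟨MvPolynomial.X i, by simp⟩
  · have h1 : Ideal.span (Set.range (MvPolynomial.X : Fin _ → MvPolynomial (Fin _) ℝ)) ≤
        (nilradical W).comap (MvPolynomial.aeval fun i => (b i : W)) := by
      rw [Ideal.span_le]
      rintro _ ⟨i, rfl⟩
      simpa using mem_nilradical.2 (hnil _ (b i).2)
    refine (Ideal.pow_right_mono h1 (N + 1)).trans ((Ideal.le_comap_pow _ (N + 1)).trans ?_)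
    rw [hN]
    exact le_rfl

end IsWeilAlgebra

/-! ### Evaluation of `C^∞(M) ⊗ W` at points of `M` -/

section Eval

variable {E : Type*} [NormedAddCommGroup E] [NormedSpace ℝ E] {H : Type*} [TopologicalSpace H]
  {I : ModelWithCorners ℝ E H} {M : Type*} [TopologicalSpace M] [ChartedSpace H M]
  {W : Type} [CommRing W] [Algebra ℝ W]

/-- The map `C^∞(M) ⊗ W → W` evaluating functions at a point of `M`. -/
noncomputable def evalTensor (W : Type) [CommRing W] [Algebra ℝ W] (x : M) :
    (C^∞⟮I, M; 𝓘(ℝ, ℝ), ℝ⟯ ⊗[ℝ] W) →ₐ[ℝ] W :=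
  (Algebra.TensorProduct.lid ℝ W).toAlgHom.comp
    (Algebra.TensorProduct.map (evalAt x) (AlgHom.id ℝ W))

theorem evalTensor_tmul (x : M) (f : C^∞⟮I, M; 𝓘(ℝ, ℝ), ℝ⟯) (w : W) :
    evalTensor W x (f ⊗ₜ[ℝ] w) = f x • w := by
  simp [evalTensor, evalAt_apply]

/-- The coefficients of an element of `C^∞(M) ⊗ W` in a basis of `W` are functions on `M`. -/
theorem eq_zero_of_evalTensor (b : C^∞⟮I, M; 𝓘(ℝ, ℝ), ℝ⟯ ⊗[ℝ] W)
    (h : ∀ x, evalTensor W x b = 0) : b = 0 := by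
  let bW := Module.Basis.ofVectorSpace ℝ W
  let B := Algebra.TensorProduct.basis C^∞⟮I, M; 𝓘(ℝ, ℝ), ℝ⟯ bW
  have hb := B.linearCombination_repr b
  rw [← hb, B.linearCombination_repr, ← B.repr.map_eq_zero_iff]
  ext i x
  have hx := h x
  rw [← hb, Finsupp.linearCombination_apply, Finsupp.sum, map_sum] at hx
  have hx' : ∑ j ∈ (B.repr b).support, (B.repr b j) x • bW j = 0 := by
    rw [← hx]
    refine Finset.sum_congr rfl fun j _ => ?_
    rw [Algebra.TensorProduct.basis_apply, TensorProduct.smul_tmul', evalTensor_tmul,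
      smul_eq_mul, mul_one]
  by_cases hi : i ∈ (B.repr b).support
  · exact linearIndependent_iff'.1 bW.linearIndependent _ _ hx' i hi
  · rw [Finsupp.notMem_support_iff.1 hi]
    rfl

theorem coordDetermined_tensor (hW : IsWeilAlgebra W) :
    CoordDetermined (C^∞⟮I, M; 𝓘(ℝ, ℝ), ℝ⟯ ⊗[ℝ] W) :=
  CoordDetermined.of_jointly_injective hW.coordDetermined (fun x : M => evalTensor W x)
    eq_zero_of_evalTensor

end Eval

/-! ### Polynomials that vanish to high order at the origin -/

/-- The ideal of functions `f` on `ℝⁿ` with `f (t • y) = O(t ^ N)` as `t → 0`, for every `y`. -/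
def vanishingIdeal (n N : ℕ) : Ideal (SmoothFn n) where
  carrier := {f | ∀ y : Cart n, (fun t : ℝ => f (t • y)) =O[nhds 0] fun t => t ^ N}
  add_mem' hf hg y := (hf y).add (hg y)
  zero_mem' _ := Asymptotics.isBigO_zero _ _
  smul_mem' c f hf y := by
    have hc : (fun t : ℝ => c (t • y)) =O[nhds 0] fun _ => (1 : ℝ) := by
      have hcont : Continuous fun t : ℝ => c (t • y) := c.contMDiff.continuous.comp (by fun_prop)
      exact hcont.continuousAt.isBigO_one ℝ
    simpa using hc.mul (hf y)

theorem span_coord_pow_le_vanishingIdeal (n N : ℕ) :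
    Ideal.span (Set.range (coord : Fin n → SmoothFn n)) ^ N ≤ vanishingIdeal n N := by
  induction N with
  | zero =>
    intro f _ y
    have hcont : Continuous fun t : ℝ => f (t • y) := f.contMDiff.continuous.comp (by fun_prop)
    simpa using hcont.continuousAt.isBigO_one ℝ
  | succ N ih =>
    rw [pow_succ, Ideal.mul_le]
    intro f hf g hg y
    have hg' : g ∈ vanishingIdeal n 1 := by
      refine Ideal.span_le.2 ?_ hg
      rintro _ ⟨i, rfl⟩ y
      simpa [coord_apply, mul_comm] using
        (Asymptotics.isBigO_refl (fun t : ℝ => t) (nhds 0)).const_mul_left (y i)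
    simpa [pow_succ] using (ih hf y).mul (hg' y)

theorem X_pow_dvd_of_isBigO {P : Polynomial ℝ} {N : ℕ}
    (h : (fun t => P.eval t) =O[nhds 0] fun t => t ^ N) : Polynomial.X ^ N ∣ P := by
  suffices ∀ i ≤ N, Polynomial.X ^ i ∣ P from this N le_rfl
  intro i
  induction i with
  | zero => simp
  | succ i ih =>
    intro hi
    obtain ⟨Q, rfl⟩ := ih (by omega)
    -- `Q(t) = O(t ^ (N - i))` off `0`, so `Q(0) = 0` by continuity
    have h1 : (fun t => Q.eval t) =O[nhdsWithin 0 {0}ᶜ] fun t => t ^ (N - i) := by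
      refine (((Asymptotics.isBigO_refl (fun t : ℝ => (t ^ i)⁻¹) _).mul
        (h.mono nhdsWithin_le_nhds))).congr' ?_ ?_
      · filter_upwards [self_mem_nhdsWithin] with t ht
        have ht' : t ≠ 0 := ht
        simp [ht']
      · filter_upwards [self_mem_nhdsWithin] with t ht
        have ht' : t ≠ 0 := ht
        rw [pow_sub₀ _ ht' (by omega), mul_comm]
    have h2 : Filter.Tendsto (fun t : ℝ => t ^ (N - i)) (nhdsWithin 0 {0}ᶜ) (nhds 0) := by
      have : Filter.Tendsto (fun t : ℝ => t ^ (N - i)) (nhds 0) (nhds (0 ^ (N - i))) :=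
        (continuous_pow (N - i)).tendsto 0
      rw [zero_pow (by omega)] at this
      exact this.mono_left nhdsWithin_le_nhds
    have h3 : Q.eval 0 = 0 := tendsto_nhds_unique
      ((Q.continuous.tendsto 0).mono_left nhdsWithin_le_nhds) (h1.trans_tendsto h2)
    rw [pow_succ]
    exact mul_dvd_mul_left _ (Polynomial.X_dvd_iff.2 (by rwa [Polynomial.coeff_zero_eq_eval_zero]))

/-- The coefficient of `tᵈ` in `p(t • y)` is the value at `y` of the homogeneous component of `p` of
degree `d`. -/
theorem coeff_aeval_C_mul_X {n : ℕ} (p : MvPolynomial (Fin n) ℝ) (y : Cart n) (d : ℕ) :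
    (MvPolynomial.aeval (fun i => Polynomial.C (y i) * Polynomial.X) p : Polynomial ℝ).coeff d =
      MvPolynomial.eval y (MvPolynomial.homogeneousComponent d p) := by
  induction p using MvPolynomial.induction_on' with
  | add p q hp hq => simp only [map_add, Polynomial.coeff_add, hp, hq]
  | monomial s r =>
    have h : (MvPolynomial.aeval (fun i => Polynomial.C (y i) * Polynomial.X)
        (MvPolynomial.monomial s r) : Polynomial ℝ) =
        Polynomial.C (MvPolynomial.eval y (MvPolynomial.monomial s r)) *
          Polynomial.X ^ s.degree := by
      simp only [MvPolynomial.aeval_monomial, MvPolynomial.eval_monomial, Polynomial.C_mul,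
        mul_assoc, Finsupp.degree_apply, Finsupp.prod, mul_pow, Finset.prod_mul_distrib,
        Finset.prod_pow_eq_pow_sum, map_prod, map_pow]
      rfl
    rw [h, Polynomial.coeff_C_mul_X_pow,
      MvPolynomial.homogeneousComponent_of_mem (MvPolynomial.isHomogeneous_monomial r rfl)]
    split_ifs <;> simp

/-- Functions in the `N`-th power of the ideal of the origin have no Taylor coefficients of degree
less than `N`. -/
theorem mem_idealOfVars_pow_of_polyFn_mem {n N : ℕ} {p : MvPolynomial (Fin n) ℝ}
    (h : polyFn n p ∈ Ideal.span (Set.range (coord : Fin n → SmoothFn n)) ^ N) :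
    p ∈ MvPolynomial.idealOfVars (Fin n) ℝ ^ N := by
  have hd : ∀ d < N, MvPolynomial.homogeneousComponent d p = 0 := by
    intro d hd
    refine MvPolynomial.funext fun y => ?_
    rw [← coeff_aeval_C_mul_X, map_zero]
    refine Polynomial.X_pow_dvd_iff.1 (X_pow_dvd_of_isBigO ?_) d hd
    refine (span_coord_pow_le_vanishingIdeal n N h y).congr_left fun t => ?_
    rw [polyFn_apply]
    have : ((Polynomial.aeval t).comp
        (MvPolynomial.aeval (fun i => Polynomial.C (y i) * Polynomial.X))) =
        (MvPolynomial.aeval (t • y) : MvPolynomial (Fin n) ℝ →ₐ[ℝ] ℝ) := by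
      ext i
      simp only [AlgHom.comp_apply, MvPolynomial.aeval_X, map_mul, Polynomial.aeval_C,
        Polynomial.aeval_X, Pi.smul_apply, smul_eq_mul, Algebra.algebraMap_self, RingHom.id_apply]
      exact mul_comm _ _
    have := DFunLike.congr_fun this p
    rw [AlgHom.comp_apply, Polynomial.coe_aeval_eq_eval, MvPolynomial.aeval_eq_eval] at this
    exact this.symm
  rw [MvPolynomial.mem_pow_idealOfVars_iff']
  intro x hx
  have := congrArg (MvPolynomial.coeff x) (hd _ hx)
  simpa [MvPolynomial.coeff_homogeneousComponent] using this

/-- A presentation of a Weil algebra extends from polynomials to all smooth functions. -/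
theorem IsDiskPresentation.exists_smooth_extension {W : Type} [CommRing W] [Algebra ℝ W] {m : ℕ}
    {q : MvPolynomial (Fin m) ℝ →ₐ[ℝ] W} (hq : IsDiskPresentation q) :
    ∃ q' : SmoothFn m →ₐ[ℝ] W, q'.comp (polyFn m) = q := by
  obtain ⟨-, l, hl⟩ := hq
  let J := Ideal.span (Set.range (coord : Fin m → SmoothFn m)) ^ (l + 1)
  let s : MvPolynomial (Fin m) ℝ →ₐ[ℝ] SmoothFn m ⧸ J := (Ideal.Quotient.mkₐ ℝ J).comp (polyFn m)
  have hs : Function.Surjective s := by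
    intro a
    obtain ⟨f, rfl⟩ := Ideal.Quotient.mk_surjective a
    obtain ⟨p, hp⟩ := exists_polyFn_sub_mem_pow 0 (l + 1) f
    refine ⟨p, (Ideal.Quotient.eq.2 ?_).symm⟩
    simpa using hp
  have hker : RingHom.ker s.toRingHom ≤ RingHom.ker q.toRingHom := fun p hp =>
    hl (mem_idealOfVars_pow_of_polyFn_mem (Ideal.Quotient.eq_zero_iff_mem.1 hp))
  exact ⟨(AlgHom.liftOfSurjective s hs q hker).comp (Ideal.Quotient.mkₐ ℝ J),
    AlgHom.liftOfSurjective_comp s hs q hker⟩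

/-! ### `C^∞(ℝᵏ) ⊗ W` as a quotient of `C^∞(ℝᵏ⁺ᵐ)` -/

section Thick

variable (k : ℕ) {W : Type} [CommRing W] [Algebra ℝ W] {m : ℕ}
  (q : MvPolynomial (Fin m) ℝ →ₐ[ℝ] W)

/-- `p ↦ p(y)`, as a map into `C^∞(ℝᵏ⁺ᵐ)`. -/
noncomputable def polyY (k m : ℕ) : MvPolynomial (Fin m) ℝ →ₐ[ℝ] SmoothFn (k + m) :=
  (pullback (projY k m)).comp (polyFn m)

theorem polyY_X (j : Fin m) : polyY k m (MvPolynomial.X j) = coord (Fin.natAdd k j) := by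
  rw [polyY, AlgHom.comp_apply, polyFn_X]
  rfl

theorem liftedIdeal_eq_map : liftedIdeal k q = (RingHom.ker q).map (polyY k m) := by
  rw [liftedIdeal, Ideal.map]
  congr 1
  ext h
  constructor
  · rintro ⟨p, hp, rfl⟩
    exact ⟨p, hp, rfl⟩
  · rintro ⟨p, hp, rfl⟩
    exact ⟨p, hp, rfl⟩

/-- The ideal `Ĩ` contains a power of the ideal generated by the `y`-coordinates. -/
theorem exists_span_natAdd_pow_le {q : MvPolynomial (Fin m) ℝ →ₐ[ℝ] W}
    (hq : IsDiskPresentation q) : ∃ l : ℕ,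
      Ideal.span (Set.range fun j : Fin m => (coord (Fin.natAdd k j) : SmoothFn (k + m))) ^ l ≤
        liftedIdeal k q := by
  obtain ⟨-, l, hl⟩ := hq
  refine ⟨l + 1, ?_⟩
  rw [liftedIdeal_eq_map]
  refine le_trans (le_of_eq ?_) (Ideal.map_mono hl)
  rw [Ideal.map_pow, Ideal.map_span, ← Set.range_comp]
  simp only [Function.comp_def, polyY_X]

/-- The map `W → C^∞(ℝᵏ⁺ᵐ)/Ĩ` with `q(p) ↦ [p(y)]`. -/
noncomputable def weilToQuotient (hq : Function.Surjective q) :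
    W →ₐ[ℝ] SmoothFn (k + m) ⧸ liftedIdeal k q :=
  AlgHom.liftOfSurjective q hq ((Ideal.Quotient.mkₐ ℝ (liftedIdeal k q)).comp (polyY k m))
    fun p hp => Ideal.Quotient.eq_zero_iff_mem.2 (Ideal.subset_span ⟨p, hp, rfl⟩)

theorem weilToQuotient_apply (hq : Function.Surjective q) (p : MvPolynomial (Fin m) ℝ) :
    weilToQuotient k q hq (q p) = Ideal.Quotient.mk _ (polyY k m p) :=
  AlgHom.liftOfSurjective_apply q hq _ _ p

/-- The map `C^∞(ℝᵏ) ⊗ W → C^∞(ℝᵏ⁺ᵐ)/Ĩ` with `g ⊗ q(p) ↦ [g(x) p(y)]`. -/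
noncomputable def thickMap (hq : Function.Surjective q) :
    (SmoothFn k ⊗[ℝ] W) →ₐ[ℝ] SmoothFn (k + m) ⧸ liftedIdeal k q :=
  Algebra.TensorProduct.lift ((Ideal.Quotient.mkₐ ℝ (liftedIdeal k q)).comp (pullback (projX k m)))
    (weilToQuotient k q hq) fun _ _ => Commute.all _ _

theorem thickMap_tmul (hq : Function.Surjective q) (g : SmoothFn k) (p : MvPolynomial (Fin m) ℝ) :
    thickMap k q hq (g ⊗ₜ[ℝ] q p) = Ideal.Quotient.mk (liftedIdeal k q)
      (pullback (projX k m) g * pullback (projY k m) (polyFn m p)) := by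
  rw [thickMap, Algebra.TensorProduct.lift_tmul, weilToQuotient_apply, map_mul]
  rfl

theorem thickMap_surjective (hq : IsDiskPresentation q) :
    Function.Surjective (thickMap k q hq.1) := by
  obtain ⟨l, hl⟩ := exists_span_natAdd_pow_le k hq
  -- `S` consists of the functions whose class lies in the image
  let mk := Ideal.Quotient.mkₐ ℝ (liftedIdeal k q)
  let S : Subring (SmoothFn (k + m)) := ((thickMap k q hq.1).range.comap mk).toSubring
  have hs : (Set.range fun j : Fin m => (coord (Fin.natAdd k j) : SmoothFn (k + m))) ⊆ S := by
    rintro _ ⟨j, rfl⟩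
    refine ⟨1 ⊗ₜ q (MvPolynomial.X j), ?_⟩
    refine (thickMap_tmul k q hq.1 _ _).trans ?_
    rw [map_one, one_mul, polyFn_X]
    rfl
  -- modulo the `y`-coordinates, `f(x, y)` is congruent to `f(x, 0)`
  have h0 (f : SmoothFn (k + m)) : ∃ b ∈ S, f - b ∈
      Ideal.span (Set.range fun j : Fin m => (coord (Fin.natAdd k j) : SmoothFn (k + m))) := by
    let a : Fin (k + m) → SmoothFn k := Fin.append coord fun _ => 0
    refine ⟨pullback (projX k m) (f.comp (tuple a)), ⟨(f.comp (tuple a)) ⊗ₜ q 1, ?_⟩, ?_⟩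
    · refine (thickMap_tmul k q hq.1 _ _).trans ?_
      rw [map_one, map_one, mul_one]
      rfl
    · refine op_sub_mem _ f coord (fun i => pullback (projX k m) (a i)) fun i => ?_
      refine Fin.addCases (fun i => ?_) (fun j => ?_) i
      · have : coord (Fin.castAdd m i) - pullback (projX k m) (a (Fin.castAdd m i)) = 0 := by
          simp only [a, Fin.append_left]
          exact sub_self _
        rw [this]
        exact zero_mem _
      · simp only [a, Fin.append_right, map_zero, sub_zero]
        exact Ideal.subset_span ⟨j, rfl⟩
  intro f
  obtain ⟨f, rfl⟩ := Ideal.Quotient.mk_surjective f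
  obtain ⟨b, ⟨c, hc⟩, hb⟩ := exists_mem_sub_mem_span_pow S hs h0 l f
  exact ⟨c, hc.trans (Ideal.Quotient.eq.2 (hl hb)).symm⟩

theorem thickMap_injective (hq : IsDiskPresentation q) :
    Function.Injective (thickMap k q hq.1) := by
  obtain ⟨q', hq'⟩ := hq.exists_smooth_extension
  rw [injective_iff_map_eq_zero]
  intro b hb
  refine eq_zero_of_evalTensor b fun x => ?_
  -- restrict to the fibre `{x} × ℝᵐ` and apply the extension of `q`
  let ix : Fin (k + m) → SmoothFn m := Fin.append (fun i => algebraMap ℝ _ (x i)) coord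
  let r : SmoothFn (k + m) →ₐ[ℝ] W := q'.comp (pullback (tuple ix))
  have hX (g : SmoothFn k) :
      pullback (tuple ix) (pullback (projX k m) g) = algebraMap ℝ _ (g x) := by
    ext y
    refine congrArg g (funext fun i => ?_)
    change ix (Fin.castAdd m i) y = x i
    simp only [ix, Fin.append_left]
    rfl
  have hY (g : SmoothFn m) : pullback (tuple ix) (pullback (projY k m) g) = g := by
    ext y
    refine congrArg g (funext fun i => ?_)
    change ix (Fin.natAdd k i) y = y i
    simp only [ix, Fin.append_right]
    rfl
  have hr : ∀ f ∈ liftedIdeal k q, r f = 0 := by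
    refine fun f hf => (RingHom.mem_ker (f := r)).1 (Ideal.span_le.2 ?_ hf)
    rintro _ ⟨p, hp, rfl⟩
    refine (congrArg q' (hY (polyFn m p))).trans ?_
    rw [← AlgHom.comp_apply, hq', hp]
  have h : (Ideal.Quotient.liftₐ (liftedIdeal k q) r hr).comp (thickMap k q hq.1) =
      evalTensor W x := by
    refine Algebra.TensorProduct.ext' fun g w => ?_
    obtain ⟨p, rfl⟩ := hq.1 w
    rw [AlgHom.comp_apply, thickMap_tmul, evalTensor_tmul]
    change q' (pullback (tuple ix) _) = _
    rw [map_mul, hX, hY, map_mul, AlgHom.commutes, ← AlgHom.comp_apply, hq', Algebra.smul_def]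
  rw [← h, AlgHom.comp_apply, hb, map_zero]

/-- The isomorphism `C^∞(ℝᵏ) ⊗ W ≅ C^∞(ℝᵏ⁺ᵐ)/Ĩ`. -/
noncomputable def thickEquiv (hq : IsDiskPresentation q) :
    (SmoothFn k ⊗[ℝ] W) ≃ₐ[ℝ] SmoothFn (k + m) ⧸ liftedIdeal k q :=
  AlgEquiv.ofBijective (thickMap k q hq.1) ⟨thickMap_injective k q hq, thickMap_surjective k q hq⟩

end Thick

/-! ### The `C^∞`-algebra structure on `C^∞(ℝᵏ) ⊗ W` -/

/-- Transport of a `C^∞`-algebra structure along an isomorphism of `ℝ`-algebras. -/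
@[reducible]
def CInftyAlgebra.ofAlgEquiv {A B : Type*} [CommRing A] [Algebra ℝ A] [CommRing B] [Algebra ℝ B]
    [CInftyAlgebra B] (e : A ≃ₐ[ℝ] B) : CInftyAlgebra A where
  op f a := e.symm (CInftyAlgebra.op f fun i => e (a i))
  op_coord i a := by simp [CInftyAlgebra.op_coord]
  op_comp f g a := by simp [CInftyAlgebra.op_comp]
  op_add a b := by
    have h : (fun i => e (![a, b] i)) = ![e a, e b] := by
      funext i
      fin_cases i <;> rfl
    rw [h, CInftyAlgebra.op_add, ← map_add, e.symm_apply_apply]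
  op_mul a b := by
    have h : (fun i => e (![a, b] i)) = ![e a, e b] := by
      funext i
      fin_cases i <;> rfl
    rw [h, CInftyAlgebra.op_mul, ← map_mul, e.symm_apply_apply]
  op_const r := by
    have h : (fun i => e (![] i)) = ![] := by
      funext i
      exact i.elim0
    rw [h, CInftyAlgebra.op_const, AlgEquiv.commutes]

theorem IsWeilAlgebra.nonempty_cinftyAlgebra_tensor {W : Type} [CommRing W] [Algebra ℝ W]
    (hW : IsWeilAlgebra W) (k : ℕ) : Nonempty (CInftyAlgebra (SmoothFn k ⊗[ℝ] W)) := by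
  obtain ⟨m, q, hq⟩ := hW.exists_isDiskPresentation
  exact ⟨CInftyAlgebra.ofAlgEquiv (thickEquiv k q hq)⟩

/-- `W ≅ C^∞(ℝ⁰) ⊗ W`. -/
theorem IsWeilAlgebra.nonempty_cinftyAlgebra {W : Type} [CommRing W] [Algebra ℝ W]
    (hW : IsWeilAlgebra W) : Nonempty (CInftyAlgebra W) := by
  obtain ⟨inst⟩ := hW.nonempty_cinftyAlgebra_tensor 0
  have h : Function.Bijective (Algebra.ofId ℝ (SmoothFn 0)) := by
    refine ⟨fun a b hab => congrArg (fun f : SmoothFn 0 => f 0) hab, fun f => ⟨f 0, ?_⟩⟩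
    ext x
    exact congrArg f (Subsingleton.elim _ _)
  exact ⟨CInftyAlgebra.ofAlgEquiv ((Algebra.TensorProduct.lid ℝ W).symm.trans
    (Algebra.TensorProduct.congr (AlgEquiv.ofBijective _ h) AlgEquiv.refl))⟩

/-- The components of `ψ` are representatives of the images of the coordinates. -/
theorem exists_pullback_of_coordDetermined {n k' : ℕ} {J : Ideal (SmoothFn n)}
    (h : CoordDetermined (SmoothFn n ⧸ J)) (φ : SmoothFn k' →ₐ[ℝ] SmoothFn n ⧸ J) :
    ∃ ψ : C^∞⟮𝓘(ℝ, Cart n), Cart n; 𝓘(ℝ, Cart k'), Cart k'⟯,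
      ∀ f, φ f = Ideal.Quotient.mk J (pullback ψ f) := by
  choose a ha using fun i => Ideal.Quotient.mk_surjective (φ (coord i))
  refine ⟨tuple a, fun f => ?_⟩
  exact DFunLike.congr_fun
    (h _ φ ((Ideal.Quotient.mkₐ ℝ J).comp (pullback (tuple a))) fun i => (ha i).symm) f

/-! ### `C^∞(ℝᵏ) ⊗ W` is a coproduct of `C^∞`-algebras -/

theorem IsCInftyHom.comp {A B C : Type*} [CommRing A] [Algebra ℝ A] [CInftyAlgebra A] [CommRing B]
    [Algebra ℝ B] [CInftyAlgebra B] [CommRing C] [Algebra ℝ C] [CInftyAlgebra C] {ψ : B →ₐ[ℝ] C}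
    {φ : A →ₐ[ℝ] B} (hψ : IsCInftyHom ψ) (hφ : IsCInftyHom φ) : IsCInftyHom (ψ.comp φ) :=
  fun f a => by
    rw [AlgHom.comp_apply, hφ, hψ]
    rfl

theorem isCInftyHom_quotient_lift {n : ℕ} {T : Type*} [CommRing T] [Algebra ℝ T] [CInftyAlgebra T]
    (J : Ideal (SmoothFn n)) {φ : SmoothFn n →ₐ[ℝ] T} (hφ : IsCInftyHom φ)
    (hJ : ∀ f ∈ J, φ f = 0) : IsCInftyHom (Ideal.Quotient.liftₐ J φ hJ) := by
  intro r f b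
  choose a ha using fun i => Ideal.Quotient.mk_surjective (b i)
  obtain rfl : (fun i => Ideal.Quotient.mk J (a i)) = b := funext ha
  exact (congrArg _ (quotientOp_mk J f a _ fun _ => rfl)).trans (hφ f a)

/-- The nontrivial half of the universal property of the coproduct. Under
`C^∞(ℝᵏ) ⊗ W ≅ C^∞(ℝᵏ⁺ᵐ)/Ĩ`, the map `α ⊗ β` is induced by the `C^∞`-map out of the free algebra
`C^∞(ℝᵏ⁺ᵐ)` that sends `xᵢ` to `α(xᵢ)` and `yⱼ` to `β(q(yⱼ))`. -/
theorem IsWeilAlgebra.isCInftyHom_tensor_lift {k : ℕ} {W : Type} [CommRing W] [Algebra ℝ W]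
    (hW : IsWeilAlgebra W) [CInftyAlgebra (SmoothFn k ⊗[ℝ] W)] {T : Type*} [CommRing T]
    [Algebra ℝ T] [CInftyAlgebra T] {α : SmoothFn k →ₐ[ℝ] T} (hα : IsCInftyHom α)
    (β : W →ₐ[ℝ] T) :
    IsCInftyHom (Algebra.TensorProduct.lift α β fun _ _ => Commute.all _ _) := by
  obtain ⟨m, q, hq⟩ := hW.exists_isDiskPresentation
  let γ : SmoothFn (k + m) →ₐ[ℝ] T :=
    opHom (Fin.append (fun i => α (coord i)) fun j => β (q (MvPolynomial.X j)))
  have hX : γ.comp (pullback (projX k m)) = α := by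
    have h : IsCInftyHom (pullback (projX k m)) := fun _ _ => rfl
    rw [IsCInftyHom.eq_opHom (IsCInftyHom.comp (isCInftyHom_opHom _) h), IsCInftyHom.eq_opHom hα]
    congr 1
    funext i
    refine (opHom_coord _ (Fin.castAdd m i)).trans ?_
    rw [Fin.append_left]
    exact opHom_coord (fun i => α (coord i)) i
  have hY : γ.comp (polyY k m) = β.comp q := by
    ext j
    rw [AlgHom.comp_apply, polyY_X, opHom_coord, Fin.append_right]
    rfl
  have hγ : ∀ f ∈ liftedIdeal k q, γ f = 0 := by
    refine fun f hf => (RingHom.mem_ker (f := γ)).1 (Ideal.span_le.2 ?_ hf)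
    rintro _ ⟨p, hp, rfl⟩
    refine (DFunLike.congr_fun hY p).trans ?_
    rw [AlgHom.comp_apply, hp, map_zero]
  have he : CoordDetermined (SmoothFn (k + m) ⧸ liftedIdeal k q) :=
    (coordDetermined_tensor hW).of_algEquiv (thickEquiv k q hq)
  have h₁ : IsCInftyHom (Ideal.Quotient.liftₐ (liftedIdeal k q) γ hγ) :=
    isCInftyHom_quotient_lift _ (isCInftyHom_opHom _) hγ
  have h₂ : IsCInftyHom (thickEquiv k q hq).toAlgHom := he.isCInftyHom _
  have h : (Ideal.Quotient.liftₐ (liftedIdeal k q) γ hγ).comp (thickEquiv k q hq).toAlgHom =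
      Algebra.TensorProduct.lift α β fun _ _ => Commute.all _ _ := by
    refine Algebra.TensorProduct.ext' fun g w => ?_
    obtain ⟨p, rfl⟩ := hq.1 w
    rw [Algebra.TensorProduct.lift_tmul, AlgHom.comp_apply]
    change Ideal.Quotient.liftₐ (liftedIdeal k q) γ hγ (thickMap k q hq.1 (g ⊗ₜ[ℝ] q p)) = _
    rw [thickMap_tmul]
    refine (map_mul γ _ _).trans ?_
    exact congrArg₂ (· * ·) (DFunLike.congr_fun hX g) (DFunLike.congr_fun hY p)
  rw [← h]
  intro n f a
  exact IsCInftyHom.comp h₁ h₂ f a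

section Tensor

variable {k : ℕ} {B W A : CInftyAlgCat}

/-- The `ℝ`-algebra map `B ⊗_ℝ W → A` induced by a cocone of `C^∞`-algebras under `B` and `W`. -/
noncomputable def comparison (inl : B ⟶ A) (inr : W ⟶ A) :
    (B.carrier ⊗[ℝ] W.carrier) →ₐ[ℝ] A.carrier :=
  Algebra.TensorProduct.lift inl.hom inr.hom fun _ _ => Commute.all _ _

theorem eq_comparison {inl : B ⟶ A} {inr : W ⟶ A}
    {φ : (B.carrier ⊗[ℝ] W.carrier) →ₐ[ℝ] A.carrier}
    (hl : ∀ b, φ (b ⊗ₜ 1) = inl.hom b) (hr : ∀ w, φ (1 ⊗ₜ w) = inr.hom w) :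
    φ = comparison inl inr := by
  refine Algebra.TensorProduct.ext (AlgHom.ext fun b => ?_) (AlgHom.ext fun w => ?_)
  · simpa [comparison] using hl b
  · simpa [comparison] using hr w

theorem comparison_comp {T : CInftyAlgCat} (inl : B ⟶ A) (inr : W ⟶ A) (d : A ⟶ T) :
    d.hom.comp (comparison inl inr) = comparison (inl ≫ d) (inr ≫ d) :=
  eq_comparison
    (fun b => congrArg d.hom (by simp [comparison])) fun w => congrArg d.hom (by simp [comparison])

/-- The isomorphism `σ` allows `B` to be, for instance, `C^∞(U)` for `U` diffeomorphic to `ℝᵏ`. -/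
theorem isCInftyTensor_of_bijective (σ : SmoothFn k ≃ₐ[ℝ] B.carrier)
    (hσ : IsCInftyHom σ.toAlgHom) (hW : IsWeilAlgebra W.carrier) (inl : B ⟶ A) (inr : W ⟶ A)
    (h : Function.Bijective (comparison inl inr)) : IsCInftyTensor inl inr := by
  obtain ⟨inst⟩ := hW.nonempty_cinftyAlgebra_tensor k
  let e : (SmoothFn k ⊗[ℝ] W.carrier) ≃ₐ[ℝ] A.carrier :=
    (Algebra.TensorProduct.congr σ AlgEquiv.refl).trans (AlgEquiv.ofBijective _ h)
  have hl (b : B.carrier) : e.symm (inl.hom b) = σ.symm b ⊗ₜ 1 := by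
    rw [AlgEquiv.symm_apply_eq]
    simp [e, comparison]
  have hr (w : W.carrier) : e.symm (inr.hom w) = 1 ⊗ₜ w := by
    rw [AlgEquiv.symm_apply_eq]
    simp [e, comparison]
  have hfac (T : CInftyAlgCat) (f : B ⟶ T) (g : W ⟶ T) :
      ∃ d : A ⟶ T, inl ≫ d = f ∧ inr ≫ d = g := by
    let L : (SmoothFn k ⊗[ℝ] W.carrier) →ₐ[ℝ] T.carrier :=
      Algebra.TensorProduct.lift (f.hom.comp σ.toAlgHom) g.hom fun _ _ => Commute.all _ _
    have hL : IsCInftyHom L :=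
      hW.isCInftyHom_tensor_lift (IsCInftyHom.comp f.isCInftyHom hσ) g.hom
    have he : IsCInftyHom e.symm.toAlgHom := (coordDetermined_tensor hW).isCInftyHom _
    refine ⟨⟨L.comp e.symm.toAlgHom, IsCInftyHom.comp hL he⟩, ?_, ?_⟩
    · refine CInftyAlgCat.Hom.ext (AlgHom.ext fun b => (congrArg L (hl b)).trans ?_)
      simp [L]
    · refine CInftyAlgCat.Hom.ext (AlgHom.ext fun w => (congrArg L (hr w)).trans ?_)
      simp [L]
  have huniq {T : CInftyAlgCat} (d d' : A ⟶ T) (h₁ : inl ≫ d = inl ≫ d')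
      (h₂ : inr ≫ d = inr ≫ d') : d = d' := by
    have hd : d.hom.comp (comparison inl inr) = d'.hom.comp (comparison inl inr) := by
      rw [comparison_comp, comparison_comp, h₁, h₂]
    refine CInftyAlgCat.Hom.ext (AlgHom.ext fun a => ?_)
    obtain ⟨x, rfl⟩ := h.2 a
    exact DFunLike.congr_fun hd x
  choose d hd₁ hd₂ using hfac
  exact ⟨BinaryCofan.IsColimit.mk _ (fun {T} f g => d T f g) (fun f g => hd₁ _ f g)
    (fun f g => hd₂ _ f g) fun {T} f g d' h₁ h₂ =>
      huniq d' (d T f g) (h₁.trans (hd₁ T f g).symm) (h₂.trans (hd₂ T f g).symm)⟩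

/-- `⊗_∞` with a Weil algebra is computed by the tensor product of `ℝ`-algebras. -/
theorem isCInftyTensor_iff_bijective (σ : SmoothFn k ≃ₐ[ℝ] B.carrier)
    (hσ : IsCInftyHom σ.toAlgHom) (hW : IsWeilAlgebra W.carrier) (inl : B ⟶ A) (inr : W ⟶ A) :
    IsCInftyTensor inl inr ↔ Function.Bijective (comparison inl inr) := by
  refine ⟨fun ⟨hA⟩ => ?_, isCInftyTensor_of_bijective σ hσ hW inl inr⟩
  obtain ⟨inst⟩ := hW.nonempty_cinftyAlgebra_tensor k
  let A' : CInftyAlgCat := .of (SmoothFn k ⊗[ℝ] W.carrier)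
  have hA' : CoordDetermined A'.carrier := coordDetermined_tensor hW
  let c : (B.carrier ⊗[ℝ] W.carrier) ≃ₐ[ℝ] A'.carrier :=
    Algebra.TensorProduct.congr σ.symm AlgEquiv.refl
  let inl' : B ⟶ A' :=
    CInftyAlgCat.Hom.mk (c.toAlgHom.comp Algebra.TensorProduct.includeLeft) (hA'.isCInftyHom _)
  let inr' : W ⟶ A' :=
    CInftyAlgCat.Hom.mk (c.toAlgHom.comp Algebra.TensorProduct.includeRight) (hA'.isCInftyHom _)
  have hc : c.toAlgHom = comparison inl' inr' := eq_comparison (fun _ => rfl) fun _ => rfl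
  obtain ⟨hA''⟩ := isCInftyTensor_of_bijective σ hσ hW inl' inr' (hc ▸ c.bijective)
  let i : A' ≅ A := hA''.coconePointUniqueUpToIso hA
  have hi₁ : inl' ≫ i.hom = inl := hA''.comp_coconePointUniqueUpToIso_hom hA ⟨WalkingPair.left⟩
  have hi₂ : inr' ≫ i.hom = inr := hA''.comp_coconePointUniqueUpToIso_hom hA ⟨WalkingPair.right⟩
  have hbij : Function.Bijective (CInftyAlgCat.Hom.hom i.hom) :=
    Function.bijective_iff_has_inverse.2 ⟨CInftyAlgCat.Hom.hom i.inv,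
      fun a => congrArg (fun φ => CInftyAlgCat.Hom.hom φ a) i.hom_inv_id,
      fun a => congrArg (fun φ => CInftyAlgCat.Hom.hom φ a) i.inv_hom_id⟩
  have : (CInftyAlgCat.Hom.hom i.hom).comp c.toAlgHom = comparison inl inr := by
    rw [hc, comparison_comp, hi₁, hi₂]
  rw [← this]
  exact hbij.comp c.bijective

end Tensor

/-! ### Thickened Cartesian spaces -/

theorem IsWeilAlgebra.exists_comparison_eq {k : ℕ} {W A : CInftyAlgCat}
    (hW : IsWeilAlgebra W.carrier) (e : (SmoothFn k ⊗[ℝ] W.carrier) ≃ₐ[ℝ] A.carrier) :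
    ∃ (inl : CInftyAlgCat.of (SmoothFn k) ⟶ A) (inr : W ⟶ A), e.toAlgHom = comparison inl inr := by
  have hA : CoordDetermined A.carrier := (coordDetermined_tensor hW).of_algEquiv e
  let inl : CInftyAlgCat.of (SmoothFn k) ⟶ A :=
    CInftyAlgCat.Hom.mk (e.toAlgHom.comp Algebra.TensorProduct.includeLeft) (hA.isCInftyHom _)
  let inr : W ⟶ A :=
    CInftyAlgCat.Hom.mk (e.toAlgHom.comp Algebra.TensorProduct.includeRight) (hA.isCInftyHom _)
  exact ⟨inl, inr, eq_comparison (B := .of (SmoothFn k)) (φ := e.toAlgHom) (inl := inl)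
    (inr := inr) (fun _ => rfl) fun _ => rfl⟩

/-- Being a thickened Cartesian space is a property of the underlying `ℝ`-algebra. -/
theorem isThickenedAlg_iff (A : CInftyAlgCat) :
    IsThickenedCInftyAlg A ↔ IsThickenedAlg (CInftyAlgCat.forgetToAlg.obj A) := by
  constructor
  · rintro ⟨k, W, inl, inr, hW, h⟩
    rw [isCInftyTensor_iff_bijective AlgEquiv.refl (fun _ _ => rfl) hW] at h
    exact ⟨k, W.carrier, inferInstance, inferInstance, hW, ⟨AlgEquiv.ofBijective _ h⟩⟩
  · rintro ⟨k, W, _, _, hW, ⟨e⟩⟩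
    obtain ⟨inst⟩ := hW.nonempty_cinftyAlgebra
    obtain ⟨inl, inr, h⟩ := hW.exists_comparison_eq (W := .of W) e
    exact ⟨k, .of W, inl, inr, hW,
      isCInftyTensor_of_bijective AlgEquiv.refl (fun _ _ => rfl) hW _ _ (h ▸ e.bijective)⟩

theorem IsThickenedAlg.coordDetermined {A : CommAlgCat.{0} ℝ} (hA : IsThickenedAlg A) :
    CoordDetermined A := by
  obtain ⟨k, W, _, _, hW, ⟨e⟩⟩ := hA
  exact (coordDetermined_tensor hW).of_algEquiv e

theorem IsThickenedCInftyAlg.coordDetermined {A : CInftyAlgCat} (hA : IsThickenedCInftyAlg A) :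
    CoordDetermined A.carrier :=
  IsThickenedAlg.coordDetermined ((isThickenedAlg_iff A).1 hA)

/-- An `ℝ`-algebra map of thickened Cartesian spaces, as a `C^∞`-map. -/
def IsThickenedCInftyAlg.homOfAlgHom {A B : CInftyAlgCat} (hB : IsThickenedCInftyAlg B)
    (φ : A.carrier →ₐ[ℝ] B.carrier) : A ⟶ B :=
  CInftyAlgCat.Hom.mk φ (hB.coordDetermined.isCInftyHom φ)

theorem IsThickenedAlg.nontrivial {A : CommAlgCat.{0} ℝ} (hA : IsThickenedAlg A) :
    Nontrivial A := by
  obtain ⟨k, W, _, _, hW, ⟨e⟩⟩ := hA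
  have := hW.1
  exact ((evalTensor W (0 : Cart k)).comp e.symm.toAlgHom).toRingHom.domain_nontrivial

theorem IsThickenedAlg.nonempty_cinftyAlgebra {A : CommAlgCat.{0} ℝ} (hA : IsThickenedAlg A) :
    Nonempty (CInftyAlgebra A) := by
  obtain ⟨k, W, _, _, hW, ⟨e⟩⟩ := hA
  obtain ⟨inst⟩ := hW.nonempty_cinftyAlgebra_tensor k
  exact ⟨CInftyAlgebra.ofAlgEquiv e.symm⟩

/-- The functor from thickened Cartesian `C^∞`-algebras to their underlying `ℝ`-algebras. -/
def forgetThickened : IsThickenedCInftyAlg.FullSubcategory ⥤ IsThickenedAlg.FullSubcategory :=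
  IsThickenedAlg.lift (IsThickenedCInftyAlg.ι ⋙ CInftyAlgCat.forgetToAlg)
    fun A => (isThickenedAlg_iff A.obj).1 A.property

/-- A thickened Cartesian `ℝ`-algebra with its unique `C^∞`-algebra structure. -/
noncomputable def enrich (A : IsThickenedAlg.FullSubcategory) :
    IsThickenedCInftyAlg.FullSubcategory :=
  letI := A.property.nonempty_cinftyAlgebra.some
  ⟨.of A.obj, (isThickenedAlg_iff _).2 A.property⟩

/-- The inverse of `forgetThickened`. -/
noncomputable def enrichThickened :
    IsThickenedAlg.FullSubcategory ⥤ IsThickenedCInftyAlg.FullSubcategory where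
  obj A := enrich A
  map {A B} f := ObjectProperty.homMk
    (IsThickenedCInftyAlg.homOfAlgHom (A := (enrich A).obj) (enrich B).property f.hom.hom)
  map_id _ := rfl
  map_comp _ _ := rfl

instance : forgetThickened.Faithful where
  map_injective {A B f g} h := by
    have h' : f.hom.hom = g.hom.hom := congrArg (fun φ => φ.hom.hom) h
    exact ObjectProperty.hom_ext _ (CInftyAlgCat.Hom.ext h')

/-- Enriching does not change the underlying algebra, so the equality is definitional. -/
theorem enrichThickened_comp_forgetThickened : enrichThickened ⋙ forgetThickened = 𝟭 _ := rfl

/-- By uniqueness, the chosen `C^∞`-structure is the given one. -/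
theorem enrich_forgetThickened_obj (A : IsThickenedCInftyAlg.FullSubcategory) :
    enrich (forgetThickened.obj A) = A := by
  obtain ⟨⟨A⟩, hA⟩ := A
  have := (IsThickenedCInftyAlg.coordDetermined hA).subsingleton
  unfold enrich
  congr 2
  exact this.elim _ _

/-- Faithfulness for arrows whose sources and targets are only propositionally equal. -/
theorem heq_of_heq_map {C D : Type*} [Category C] [Category D] (F : C ⥤ D) [F.Faithful]
    {X Y X' Y' : C} {f : X ⟶ Y} {g : X' ⟶ Y'} (hX : X = X') (hY : Y = Y')
    (h : HEq (F.map f) (F.map g)) : HEq f g := by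
  subst hX hY
  exact heq_of_eq (F.map_injective (eq_of_heq h))

theorem forgetThickened_comp_enrichThickened : forgetThickened ⋙ enrichThickened = 𝟭 _ :=
  CategoryTheory.Functor.hext enrich_forgetThickened_obj fun A B _ =>
    heq_of_heq_map forgetThickened (enrich_forgetThickened_obj A) (enrich_forgetThickened_obj B)
      HEq.rfl

/-! ### Good open covers -/

/-- Pullback of smooth functions along a diffeomorphism `U ≅ ℝᵏ`. -/
noncomputable def diffeoEquiv {k : ℕ} {U : Opens (Cart k)}
    (d : U ≃ₘ⟮𝓘(ℝ, Cart k), 𝓘(ℝ, Cart k)⟯ Cart k) : SmoothFn k ≃ₐ[ℝ] SmoothFnOn U where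
  toFun f := f.comp d.toContMDiffMap
  invFun f := f.comp d.symm.toContMDiffMap
  left_inv f := by
    ext x
    exact congrArg f (d.apply_symm_apply x)
  right_inv f := by
    ext x
    exact congrArg f (d.symm_apply_apply x)
  map_mul' _ _ := rfl
  map_add' _ _ := rfl
  commutes' _ := rfl

theorem isCInftyHom_diffeoEquiv {k : ℕ} {U : Opens (Cart k)}
    (d : U ≃ₘ⟮𝓘(ℝ, Cart k), 𝓘(ℝ, Cart k)⟯ Cart k) : IsCInftyHom (diffeoEquiv d).toAlgHom :=
  fun _ _ => rfl

/-- If `C^∞(U)` maps to a nontrivial ring, then `U` is nonempty. -/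
theorem ne_bot_of_algHom {k : ℕ} {U : Opens (Cart k)} {R : Type*} [CommRing R] [Algebra ℝ R]
    [Nontrivial R] (φ : SmoothFnOn U →ₐ[ℝ] R) : U ≠ ⊥ := by
  rintro rfl
  have h : (0 : SmoothFnOn (⊥ : Opens (Cart k))) = 1 := by
    ext x
    exact x.2.elim
  have h' := congrArg φ h
  rw [map_zero, map_one] at h'
  exact zero_ne_one h'

/-- A nonempty member of a good open cover is diffeomorphic to `ℝᵏ`. -/
theorem IsGoodOpenCover.nonempty_diffeomorph {k : ℕ} {ι : Type} {U : ι → Opens (Cart k)}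
    (hU : IsGoodOpenCover U) {i : ι} (hi : U i ≠ ⊥) :
    Nonempty (U i ≃ₘ⟮𝓘(ℝ, Cart k), 𝓘(ℝ, Cart k)⟯ Cart k) := by
  have h := hU.2 {i} (Finset.singleton_nonempty i)
  rw [Finset.inf_singleton] at h
  exact h hi

/-- Empty members do not occur in either kind of cover: `C^∞(∅) = 0` has no algebra map to the
nontrivial algebra of functions on `Y i`. -/
theorem isCInftyGoodCover_iff {X : CInftyThCartSp} {ι : Type} (Y : ι → CInftyThCartSp)
    (f : ∀ i, Y i ⟶ X) : IsCInftyGoodCover Y f ↔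
      IsGoodCover (fun i => forgetThickened.op.obj (Y i))
        fun i => forgetThickened.op.map (f i) := by
  have hnt (i : ι) : Nontrivial (Y i).unop.obj.carrier :=
    IsThickenedAlg.nontrivial ((isThickenedAlg_iff _).1 (Y i).unop.property)
  constructor
  · rintro ⟨k, W, U, inl, inr, inl', inr', hW, hU, hX, hY⟩
    have hY' (i : ι) : Function.Bijective (comparison (inl' i) (inr' i)) := by
      obtain ⟨d⟩ := hU.nonempty_diffeomorph (ne_bot_of_algHom (inl' i).hom)
      exact (isCInftyTensor_iff_bijective (diffeoEquiv d) (isCInftyHom_diffeoEquiv d) hW _ _).1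
        (hY i).1
    have hX' : Function.Bijective (comparison inl inr) :=
      (isCInftyTensor_iff_bijective AlgEquiv.refl (fun _ _ => rfl) hW _ _).1 hX
    refine ⟨k, W.carrier, inferInstance, inferInstance, U, AlgEquiv.ofBijective _ hX',
      fun i => AlgEquiv.ofBijective _ (hY' i), hW, hU, fun i => ?_⟩
    obtain ⟨-, h₁, h₂⟩ := hY i
    refine (comparison_comp inl inr (f i).unop.hom).trans ?_
    rw [h₁, h₂]
    refine (eq_comparison (fun b => ?_) fun w => ?_).symm
    · change comparison (inl' i) (inr' i) (restrict (U i) b ⊗ₜ (1 : W.carrier)) =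
        (inl' i).hom (restrict (U i) b)
      simp [comparison]
    · change comparison (inl' i) (inr' i) (restrict (U i) 1 ⊗ₜ w) = (inr' i).hom w
      simp [comparison]
  · rintro ⟨k, W, _, _, U, e, e', hW, hU, hf⟩
    obtain ⟨inst⟩ := hW.nonempty_cinftyAlgebra
    obtain ⟨inl, inr, he⟩ := hW.exists_comparison_eq (W := .of W) (A := X.unop.obj) e
    let inl' (i : ι) : CInftyAlgCat.of (SmoothFnOn (U i)) ⟶ (Y i).unop.obj :=
      (Y i).unop.property.homOfAlgHom
        ((e' i).toAlgHom.comp Algebra.TensorProduct.includeLeft)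
    let inr' (i : ι) : CInftyAlgCat.of W ⟶ (Y i).unop.obj :=
      (Y i).unop.property.homOfAlgHom
        ((e' i).toAlgHom.comp Algebra.TensorProduct.includeRight)
    have he' (i : ι) : (e' i).toAlgHom = comparison (inl' i) (inr' i) :=
      eq_comparison (B := .of (SmoothFnOn (U i))) (φ := (e' i).toAlgHom) (inl := inl' i)
        (inr := inr' i) (fun _ => rfl) fun _ => rfl
    have hl (b : SmoothFn k) : inl.hom b = e (b ⊗ₜ 1) :=
      (DFunLike.congr_fun he (b ⊗ₜ (1 : W))).trans (by simp [comparison]) |>.symm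
    have hr (w : W) : inr.hom w = e (1 ⊗ₜ w) :=
      (DFunLike.congr_fun he ((1 : SmoothFn k) ⊗ₜ w)).trans (by simp [comparison]) |>.symm
    refine ⟨k, .of W, U, inl, inr, inl', inr', hW, hU,
      isCInftyTensor_of_bijective AlgEquiv.refl (fun _ _ => rfl) hW _ _ (he ▸ e.bijective),
      fun i => ⟨?_, ?_, ?_⟩⟩
    · obtain ⟨d⟩ := hU.nonempty_diffeomorph (ne_bot_of_algHom (inl' i).hom)
      exact isCInftyTensor_of_bijective (diffeoEquiv d) (isCInftyHom_diffeoEquiv d) hW _ _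
        (he' i ▸ (e' i).bijective)
    · refine CInftyAlgCat.Hom.ext (AlgHom.ext fun b => ?_)
      refine (congrArg (f i).unop.hom.hom (hl b)).trans ?_
      refine (DFunLike.congr_fun (hf i) (b ⊗ₜ (1 : W))).trans ?_
      rfl
    · refine CInftyAlgCat.Hom.ext (AlgHom.ext fun w => ?_)
      refine (congrArg (f i).unop.hom.hom (hr w)).trans ?_
      refine (DFunLike.congr_fun (hf i) ((1 : SmoothFn k) ⊗ₜ w)).trans ?_
      rfl

/-! ### Isomorphisms of categories and coverages -/

section Sites

universe v₁ v₂ u₁ u₂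

variable {C : Type u₁} [Category.{v₁} C] {D : Type u₂} [Category.{v₂} D]

theorem functorPushforward_mem_of_mem_comap (F : C ⥤ D) [F.IsEquivalence] (K : Precoverage D)
    {X : C} {S : Sieve X} (hS : S ∈ (K.comap F).toGrothendieck X) :
    S.functorPushforward F ∈ K.toGrothendieck (F.obj X) := by
  have h := Precoverage.toGrothendieck_comap_le_restrictedTopology (F := F) K X hS
  rwa [Functor.restrictedTopology_eq_inducedTopology,
    Functor.mem_inducedTopology_iff_of_isCoverDense] at h

theorem mem_of_functorPushforward_mem {H : C ⥤ C} (hH : H = 𝟭 C) (J : GrothendieckTopology C)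
    {X : C} {S : Sieve X} (h : S.functorPushforward H ∈ J (H.obj X)) : S ∈ J X := by
  subst hH
  rwa [Sieve.functorPushforward_id] at h

/-- An isomorphism of categories is an isomorphism of sites for a coverage and its preimage. -/
theorem isDenseSubsite_comap (F : C ⥤ D) (G : D ⥤ C) (hFG : F ⋙ G = 𝟭 C) (hGF : G ⋙ F = 𝟭 D)
    (K : Precoverage D) [F.IsEquivalence] [G.IsEquivalence] :
    F.IsDenseSubsite (K.comap F).toGrothendieck K.toGrothendieck where
  functorPushforward_mem_iff {X S} := by
    refine ⟨fun h => ?_, functorPushforward_mem_of_mem_comap F K⟩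
    have hK : (K.comap F).comap G = K := by
      rw [← Precoverage.comap_comp, hGF, Precoverage.comap_id]
    have h' := functorPushforward_mem_of_mem_comap G (K.comap F) (S := S.functorPushforward F)
      (by rwa [hK])
    rw [← Sieve.functorPushforward_comp] at h'
    exact mem_of_functorPushforward_mem hFG _ h'

/-- Equality in the sigma type expresses `Y = F.obj Z` and `u = F.map g` at once. -/
theorem exists_eq_of_map {F : C ⥤ D} {X : C} {R : Presieve X} {Y : D} {u : Y ⟶ F.obj X}
    (h : R.map F u) : ∃ (Z : C) (g : Z ⟶ X), R g ∧
      (⟨Y, u⟩ : Σ Y : D, Y ⟶ F.obj X) = ⟨F.obj Z, F.map g⟩ := by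
  obtain ⟨hg⟩ := h
  exact ⟨_, _, hg, rfl⟩

/-- For a faithful functor that is injective on objects, a family of arrows generating the image of
a presieve `R` is the image of a family generating `R`. -/
theorem exists_ofArrows_of_map_eq (F : C ⥤ D) [F.Faithful] (hF : Function.Injective F.obj) {X : C}
    {R : Presieve X} {ι : Type*} {Y : ι → D} {f : ∀ i, Y i ⟶ F.obj X}
    (h : R.map F = Presieve.ofArrows Y f) :
    ∃ (Z : ι → C) (g : ∀ i, Z i ⟶ X), R = Presieve.ofArrows Z g ∧
      (⟨Y, f⟩ : Σ Y : ι → D, ∀ i, Y i ⟶ F.obj X) =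
        ⟨fun i => F.obj (Z i), fun i => F.map (g i)⟩ := by
  have hf (i : ι) : R.map F (f i) := h ▸ Presieve.ofArrows.mk i
  choose Z g hR hZ using fun i => exists_eq_of_map (hf i)
  refine ⟨Z, g, ?_, congrArg (fun y : ι → Σ Y : D, Y ⟶ F.obj X =>
    (⟨fun i => (y i).1, fun i => (y i).2⟩ : Σ Y : ι → D, ∀ i, Y i ⟶ F.obj X)) (funext hZ)⟩
  refine le_antisymm (fun V u hu => ?_) fun _ _ ⟨i⟩ => hR i
  have hu' : Presieve.ofArrows Y f (F.map u) := h ▸ Presieve.map_map hu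
  have : ∃ i, (⟨F.obj V, F.map u⟩ : Σ Y : D, Y ⟶ F.obj X) = ⟨Y i, f i⟩ := by
    generalize F.map u = v at hu'
    generalize F.obj V = V' at v hu'
    obtain ⟨i⟩ := hu'
    exact ⟨i, rfl⟩
  obtain ⟨i, hi⟩ := this
  have hi' := hi.trans (hZ i)
  obtain rfl : V = Z i := hF (congrArg Sigma.fst hi')
  obtain rfl : u = g i := F.map_injective (eq_of_heq (Sigma.mk.inj hi').2)
  exact Presieve.ofArrows.mk i

end Sites

theorem forgetThickened_obj_injective : Function.Injective forgetThickened.obj :=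
  Function.LeftInverse.injective enrich_forgetThickened_obj

theorem cinftyGoodCoverage_eq_comap :
    cinftyGoodCoverage = goodCoverage.comap forgetThickened.op := by
  ext X R
  constructor
  · rintro ⟨ι, Y, f, rfl, h⟩
    exact ⟨ι, _, _, Presieve.map_ofArrows _, (isCInftyGoodCover_iff Y f).1 h⟩
  · rintro ⟨ι, Y, f, hR, h⟩
    obtain ⟨Z, g, rfl, hZ⟩ := exists_ofArrows_of_map_eq forgetThickened.op
      (fun A B h => Opposite.unop_injective
        (forgetThickened_obj_injective (congrArg Opposite.unop h))) hR
    cases hZ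
    exact ⟨ι, Z, g, rfl, (isCInftyGoodCover_iff Z g).2 h⟩

/-- `forgetThickened` as an equivalence of categories. -/
noncomputable def thickenedEquiv :
    IsThickenedAlg.FullSubcategory ≌ IsThickenedCInftyAlg.FullSubcategory :=
  CategoryTheory.Equivalence.mk enrichThickened forgetThickened
    (eqToIso enrichThickened_comp_forgetThickened.symm)
    (eqToIso forgetThickened_comp_enrichThickened)

/-- The equivalence of sheaf categories given by precomposition with `forgetThickened`. -/
noncomputable def sheafEquiv : ThSmoothSet ≌ CahiersTopos :=
  have : thickenedEquiv.op.inverse.IsDenseSubsite cinftyGoodCoverage.toGrothendieck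
      goodCoverage.toGrothendieck := by
    have h₁ : forgetThickened.op.IsEquivalence := thickenedEquiv.op.isEquivalence_inverse
    have h₂ : enrichThickened.op.IsEquivalence := thickenedEquiv.op.isEquivalence_functor
    rw [cinftyGoodCoverage_eq_comap]
    exact isDenseSubsite_comap forgetThickened.op enrichThickened.op
      (congrArg Functor.op forgetThickened_comp_enrichThickened) rfl goodCoverage
  thickenedEquiv.op.sheafCongr _ _ Type

end Cahiers

open Cahiers in
theorem mainTheorem1 :
    (∀ (k : ℕ) (W : Type) [CommRing W] [Algebra ℝ W], IsWeilAlgebra W →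
      (∃ (m : ℕ) (q : MvPolynomial (Fin m) ℝ →ₐ[ℝ] W), IsDiskPresentation q) ∧
      ∃ _ : CInftyAlgebra (SmoothFn k ⊗[ℝ] W),
        (∀ (m : ℕ) (q : MvPolynomial (Fin m) ℝ →ₐ[ℝ] W), IsDiskPresentation q →
          ∃ e : (SmoothFn k ⊗[ℝ] W) ≃ₐ[ℝ] (SmoothFn (k + m) ⧸ liftedIdeal k q),
            (∀ g p, e (g ⊗ₜ[ℝ] q p) = Ideal.Quotient.mk (liftedIdeal k q)
              (Cahiers.pullback (projX k m) g * Cahiers.pullback (projY k m) (polyFn m p))) ∧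
            IsCInftyHom e.toAlgHom ∧
            ∀ (k' r : ℕ) (p : Fin r → MvPolynomial (Fin k') ℝ)
              (φ : (SmoothFn k' ⧸ polyIdeal p) →ₐ[ℝ] (SmoothFn k ⊗[ℝ] W)),
              ∃ ψ : C^∞⟮𝓘(ℝ, Cart (k + m)), Cart (k + m); 𝓘(ℝ, Cart k'), Cart k'⟯,
                ∀ f, e (φ (Ideal.Quotient.mk (polyIdeal p) f)) =
                  Ideal.Quotient.mk (liftedIdeal k q) (Cahiers.pullback ψ f)) ∧
        (∀ (k' : ℕ) (φ : SmoothFn k' →ₐ[ℝ] (SmoothFn k ⊗[ℝ] W)), IsCInftyHom φ) ∧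
        (∀ (k' r : ℕ) (p : Fin r → MvPolynomial (Fin k') ℝ)
          (φ : (SmoothFn k' ⧸ polyIdeal p) →ₐ[ℝ] (SmoothFn k ⊗[ℝ] W)), IsCInftyHom φ)) ∧
    ∃ F : IsThickenedCInftyAlg.FullSubcategory ⥤ IsThickenedAlg.FullSubcategory,
      F ⋙ IsThickenedAlg.ι = IsThickenedCInftyAlg.ι ⋙ CInftyAlgCat.forgetToAlg ∧
      (∃ G : IsThickenedAlg.FullSubcategory ⥤ IsThickenedCInftyAlg.FullSubcategory,
        F ⋙ G = 𝟭 _ ∧ G ⋙ F = 𝟭 _) ∧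
      cinftyGoodCoverage = goodCoverage.comap F.op ∧
      ∃ T : ThSmoothSet ≌ CahiersTopos,
        Nonempty (T.functor ⋙ sheafToPresheaf cinftyGoodCoverage.toGrothendieck Type ≅
          sheafToPresheaf goodCoverage.toGrothendieck Type ⋙
            (Functor.whiskeringLeft _ _ Type).obj F.op.op) := by
  refine ⟨fun k W _ _ hW => ⟨hW.exists_isDiskPresentation, ?_⟩, forgetThickened, rfl,
    ⟨enrichThickened, forgetThickened_comp_enrichThickened, enrichThickened_comp_forgetThickened⟩,
    cinftyGoodCoverage_eq_comap, sheafEquiv, ⟨Iso.refl _⟩⟩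
  obtain ⟨inst⟩ := hW.nonempty_cinftyAlgebra_tensor k
  have hB : CoordDetermined (SmoothFn k ⊗[ℝ] W) := coordDetermined_tensor hW
  refine ⟨inst, fun m q hq => ?_, fun _ φ => hB.isCInftyHom φ, fun _ _ _ φ => hB.isCInftyHom φ⟩
  have hQ := hB.of_algEquiv (thickEquiv k q hq)
  refine ⟨thickEquiv k q hq, thickMap_tmul k q hq.1, hQ.isCInftyHom _, fun k' r p φ => ?_⟩
  exact exists_pullback_of_coordDetermined hQ
    (((thickEquiv k q hq).toAlgHom.comp φ).comp (Ideal.Quotient.mkₐ ℝ (polyIdeal p)))
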